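/- Let $k<n/2$ be a non-negative integer, let $p(x)=a_0+a_1x+\cdots+a_kx^k$ with real coefficients, let $h=\frac{1}{2^n+1}$ and $x_i=ih$ for $1\le i\le 2^n$. Let $A_{n,1}$ be the $2^n\times 2^n$ tridiagonal matrix with $-2$ on the diagonal and $1$ on the two neighbouring diagonals, $D_n$ the $2^n\times2^n$ matrix with $\frac{1}{2h}$ on the superdiagonal, $-\frac{1}{2h}$ on the subdiagonal and $0$ elsewhere, and $M(p(x))=\mathrm{diag}(p(x_1),\dots,p(x_{2^n}))$. For $\alpha\subseteq\{1,\dots,n\}$ let $Z_\alpha$ be the tensor product of $n$ single-qubit matrices with the Pauli matrix $Z$ at the positions in $\alpha$ and $I$ elsewhere (position $1$ being the most significant bit). Put $c_j=-\frac{2^n}{2^n+1}2^{-j}$, $c_\alpha=\prod_{j\in\alpha}c_j$, and define $c_\alpha(r)$ by $c_\emptyset(0)=1$, $c_\alpha(0)=0$ for $\alpha\neq\emptyset$, and $$c_\alpha(r+1)=\begin{cases}0 & |\alpha|>r+1,\\ (r+1)! & |\alpha|=r+1,\\ c_\alpha(r)+\sum_{l\in\alpha}c_{\alpha\setminus\{l\}}(r)+\sum_{l\notin\alpha}c_l^2\,c_{\alpha\cup\{l\}}(r)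 & |\alpha|\le r.\end{cases}$$ Then $$M(p(x))=\sum_{|\alpha|\le k}m_\alpha Z_\alpha,\qquad m_\alpha=\Bigl(\sum_{j=|\alpha|}^{k}\frac{a_j\,c_\alpha(j)}{2^j}\Bigr)c_\alpha .$$ Let $S_n$ be the increment matrix $|j\rangle\mapsto|j+1 \bmod 2^n\rangle$, let $X$ be the Pauli matrix $X$, and let $C_n^-$ be the antidiagonal matrix with $1$ in its two corners and $-1$ at the other antidiagonal positions. Then $$A_{n,1}+h^2M(p(x))D_n=-2I^{\otimes n}+S_n+S_n^\dagger-\tfrac12X^{\otimes n}+\tfrac12(-C_n^-)+\frac h2\sum_{|\alpha|\le k}m_\alpha Z_\alpha\Bigl(S_n^\dagger-S_n+\tfrac12(I^{\otimes n-1}\otimes Z)X^{\otimes n}-\tfrac12(I^{\otimes n-1}\otimes Z)(-C_n^-)\Bigr).$$ Multiplied out, this is a real linear combination $\sum_{l=1}^{L}c_{5,l}R_{5,l}$ of $L=5+4\sum_{j=0}^{k}\binom nj$ matrices $R_{5,l}$, all of which are unitary, and there is an absolute constant $C$ such that always $L\le Cn^k$. Moreover, with a single ancilla qubit in an arbitrary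 state, which is returned to that state, each $R_{5,l}$ is implemented exactly by a circuit with at most $2$ Hadamard gates, at most $k+1$ $Z$ gates, at most $Cn$ Toffoli, $X$ and $CNOT$ gates in total, and no other gates. -/

import Mathlib

namespace PoissonLCU

open Matrix Polynomial

noncomputable section

/-! ### The discretized operators on the grid `x_i = i h`, `i = 1, …, 2^n` -/

/-- The grid step `h = 1 / (2^n + 1)`. -/
def step (n : ℕ) : ℝ := 1 / ((2 : ℝ) ^ n + 1)

/-- The grid point belonging to the (zero-based) row `i`, that is `(i + 1) h`. -/
def gridPoint (n : ℕ) (i : Fin (2 ^ n)) : ℝ := ((i : ℝ) + 1) * step n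

/-- The second-order central difference Dirichlet Laplacian `L_{n,1}`. -/
def dirichletLaplacian (n : ℕ) : Matrix (Fin (2 ^ n)) (Fin (2 ^ n)) ℂ :=
  ((1 / step n ^ 2 : ℝ) : ℂ) • Matrix.of fun i j =>
    if i = j then -2
    else if i.val + 1 = j.val ∨ j.val + 1 = i.val then 1
    else 0

/-- The normalized Dirichlet Laplacian `A_{n,1} = h ^ 2 L_{n,1}`. -/
def normalizedLaplacian (n : ℕ) : Matrix (Fin (2 ^ n)) (Fin (2 ^ n)) ℂ :=
  ((step n ^ 2 : ℝ) : ℂ) • dirichletLaplacian n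

/-- The central difference first derivative `D_n`. -/
def centralDifference (n : ℕ) : Matrix (Fin (2 ^ n)) (Fin (2 ^ n)) ℂ :=
  ((1 / (2 * step n) : ℝ) : ℂ) • Matrix.of fun i j =>
    if i.val + 1 = j.val then 1
    else if j.val + 1 = i.val then -1
    else 0

/-- The matrix `M(p(x)) = diag(p(x_1), …, p(x_{2^n}))`. -/
def gridDiagonal (n : ℕ) (p : ℝ[X]) : Matrix (Fin (2 ^ n)) (Fin (2 ^ n)) ℂ :=
  Matrix.diagonal fun i => ((p.eval (gridPoint n i) : ℝ) : ℂ)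

/-! ### Qubits and tensor products -/

/-- Computational basis states as bit strings; qubit `0` carries the most significant bit, as in
the Kronecker product convention. -/
def bits (n : ℕ) : Fin (2 ^ n) ≃ (Fin n → Fin 2) :=
  finFunctionFinEquiv.symm.trans (Equiv.arrowCongr Fin.revPerm (Equiv.refl (Fin 2)))

/-- The Pauli matrix `X`. -/
def pauliX : Matrix (Fin 2) (Fin 2) ℂ := !![0, 1; 1, 0]

/-- The Pauli matrix `Z`. -/
def pauliZ : Matrix (Fin 2) (Fin 2) ℂ := !![1, 0; 0, -1]

/-- The Hadamard matrix. -/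
def hadamard : Matrix (Fin 2) (Fin 2) ℂ := ((1 / Real.sqrt 2 : ℝ) : ℂ) • !![1, 1; 1, -1]

/-- The Kronecker product `U_0 ⊗ U_1 ⊗ ⋯ ⊗ U_{n-1}` of single-qubit matrices. -/
def tensor {n : ℕ} (U : Fin n → Matrix (Fin 2) (Fin 2) ℂ) :
    Matrix (Fin (2 ^ n)) (Fin (2 ^ n)) ℂ :=
  Matrix.of fun i j => ∏ q, U q (bits n i q) (bits n j q)

/-- The Pauli string `Z_α`: `Z` on the qubits in `α` and the identity on the others. -/
def zString {n : ℕ} (α : Finset (Fin n)) : Matrix (Fin (2 ^ n)) (Fin (2 ^ n)) ℂ :=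
  tensor fun q => if q ∈ α then pauliZ else 1

/-- `I^{⊗(n-1)} ⊗ Z`. -/
def zLast (n : ℕ) : Matrix (Fin (2 ^ n)) (Fin (2 ^ n)) ℂ :=
  tensor fun q => if q.val + 1 = n then pauliZ else 1

/-- `X^{⊗n}`. -/
def xAll (n : ℕ) : Matrix (Fin (2 ^ n)) (Fin (2 ^ n)) ℂ :=
  tensor fun _ => pauliX

/-- The increment gate `S_n`, which sends `|j⟩` to `|j + 1 mod 2^n⟩`. -/
def increment (n : ℕ) : Matrix (Fin (2 ^ n)) (Fin (2 ^ n)) ℂ :=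
  Matrix.of fun i j => if (j.val + 1) % 2 ^ n = i.val then 1 else 0

/-- The matrix `C_n^-`: on the antidiagonal, `1` in the two corners and `-1` elsewhere; all other
entries vanish. -/
def cMinus (n : ℕ) : Matrix (Fin (2 ^ n)) (Fin (2 ^ n)) ℂ :=
  Matrix.of fun i j =>
    if i.val + j.val + 1 = 2 ^ n then (if i.val = 0 ∨ j.val = 0 then 1 else -1) else 0

/-! ### The expansion of `M(p(x))` into Pauli-`Z` strings -/

/-- `c_j = -(2^n / (2^n + 1)) 2^{-j}`, where the zero-based qubit `q` has `j = q + 1`. -/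
def qubitWeight (n : ℕ) (q : Fin n) : ℝ :=
  -((2 : ℝ) ^ n / ((2 : ℝ) ^ n + 1)) * ((2 : ℝ) ^ (q.val + 1))⁻¹

/-- `c_α = ∏_{j ∈ α} c_j`. -/
def stringWeight {n : ℕ} (α : Finset (Fin n)) : ℝ := ∏ q ∈ α, qubitWeight n q

/-- The numbers `c_α(r)`, given by their recursion in `r`. -/
def recCoeff (n : ℕ) : ℕ → Finset (Fin n) → ℝ
  | 0, α => if α = ∅ then 1 else 0
  | r + 1, α =>
    if r + 1 < α.card then 0
    else if α.card = r + 1 then ((r + 1).factorial : ℝ)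
    else recCoeff n r α + ∑ l ∈ α, recCoeff n r (α.erase l)
      + ∑ l ∈ αᶜ, qubitWeight n l ^ 2 * recCoeff n r (insert l α)

/-- The coefficient `(∑_{j = |α|}^{k} a_j c_α(j) / 2^j) c_α` of `Z_α` in `M(p(x))`, where
`p = a_0 + a_1 x + ⋯ + a_k x^k`. -/
def polyCoeff {n : ℕ} (k : ℕ) (p : ℝ[X]) (α : Finset (Fin n)) : ℝ :=
  (∑ j ∈ Finset.Icc α.card k, p.coeff j * recCoeff n j α / 2 ^ j) * stringWeight α

/-! ### The linear combination of unitaries -/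

/-- The sets of at most `k` qubits. -/
abbrev LowWeight (n k : ℕ) : Type := {α : Finset (Fin n) // α.card ≤ k}

/-- The index set of the linear combination: five terms for the Laplacian and, for every string
`Z_α` of weight at most `k`, four terms for the first-order part. -/
abbrev TermIndex (n k : ℕ) : Type := Fin 5 ⊕ (LowWeight n k × Fin 4)

/-- The matrices of the linear combination. -/
def lcuTerm (n k : ℕ) : TermIndex n k → Matrix (Fin (2 ^ n)) (Fin (2 ^ n)) ℂ
  | Sum.inl i => ![1, increment n, (increment n)ᴴ, xAll n, -cMinus n] i
  | Sum.inr (α, i) =>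
      zString α.1 * ![(increment n)ᴴ, increment n, zLast n * xAll n, zLast n * -cMinus n] i

/-- The coefficients of the linear combination. -/
def lcuCoeff (n k : ℕ) (p : ℝ[X]) : TermIndex n k → ℝ
  | Sum.inl i => ![-2, 1, 1, -1 / 2, 1 / 2] i
  | Sum.inr (α, i) => step n / 2 * polyCoeff k p α.1 * ![1, -1, 1 / 2, -1 / 2] i

/-! ### Circuits -/

/-- The elementary gates on `N` wires. -/
inductive Gate (N : ℕ) : Type
  | had (q : Fin N)
  | x (q : Fin N)
  | z (q : Fin N)
  | cnot (c t : Fin N) (hct : c ≠ t)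
  | toffoli (c d t : Fin N) (hcd : c ≠ d) (hct : c ≠ t) (hdt : d ≠ t)

/-- The single-qubit matrix `U` acting on the wire `q`. -/
def onWire {N : ℕ} (q : Fin N) (U : Matrix (Fin 2) (Fin 2) ℂ) :
    Matrix (Fin N → Fin 2) (Fin N → Fin 2) ℂ :=
  Matrix.of fun x y => if ∀ r, r ≠ q → x r = y r then U (x q) (y q) else 0

/-- The matrix of a map on basis states, `|y⟩ ↦ |f y⟩`. -/
def basisMap {N : ℕ} (f : (Fin N → Fin 2) → (Fin N → Fin 2)) :
    Matrix (Fin N → Fin 2) (Fin N → Fin 2) ℂ :=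
  Matrix.of fun x y => if x = f y then 1 else 0

/-- The matrix of a gate. Addition and multiplication of bits are modulo two. -/
def Gate.mat {N : ℕ} : Gate N → Matrix (Fin N → Fin 2) (Fin N → Fin 2) ℂ
  | .had q => onWire q hadamard
  | .x q => onWire q pauliX
  | .z q => onWire q pauliZ
  | .cnot c t _ => basisMap fun y => Function.update y t (y t + y c)
  | .toffoli c d t _ _ _ => basisMap fun y => Function.update y t (y t + y c * y d)

/-- A circuit: a list of gates, written as a matrix product (the last gate acts first). -/
abbrev Circuit (N : ℕ) : Type := List (Gate N)

/-- The matrix of a circuit. -/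
def circuitMat {N : ℕ} (G : Circuit N) : Matrix (Fin N → Fin 2) (Fin N → Fin 2) ℂ :=
  (G.map Gate.mat).prod

/-- Is the gate a Hadamard gate? -/
def Gate.isHad {N : ℕ} : Gate N → Bool
  | .had _ => true
  | _ => false

/-- Is the gate a `Z` gate? -/
def Gate.isZ {N : ℕ} : Gate N → Bool
  | .z _ => true
  | _ => false

/-- Is the gate a Toffoli, `X` or `CNOT` gate? -/
def Gate.isClassical {N : ℕ} : Gate N → Bool
  | .x _ => true
  | .cnot _ _ _ => true
  | .toffoli _ _ _ _ _ _ => true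
  | _ => false

/-- The circuit on `n + 1` wires, the last of which is the ancilla, acts as `R ⊗ I`: it applies
`R` to the first `n` qubits and hands the ancilla back in its initial state, whatever that is. -/
def ImplementsWithAncilla {n : ℕ} (G : Circuit (n + 1))
    (R : Matrix (Fin (2 ^ n)) (Fin (2 ^ n)) ℂ) : Prop :=
  ∀ (i j : Fin (2 ^ n)) (a b : Fin 2),
    circuitMat G (Fin.snoc (bits n i) a) (Fin.snoc (bits n j) b) = if a = b then R i j else 0

end

end PoissonLCU

namespace PoissonLCU

open Matrix Polynomial

noncomputable section

/-! ### The expansion of the diagonal matrix -/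

/-! Three independent facts carry the theorem.

Diagonal part. Writing a binary digit as `(1 - s) / 2`, where `s = ±1` is an eigenvalue of `Z`,
makes the grid points affine in the signs: `x_i = (1 + ∑ c_q s_q) / 2` (`gridPoint_eq`). Since `s_q
^ 2 = 1`, every power of `1 + ∑ c_q s_q` is multilinear in the signs. Multiplication by `c_l s_l`
sends the monomial of `α` to that of `α ∪ {l}` if `l ∉ α`, and to `c_l ^ 2` times that of `α \ {l}`
otherwise; collecting coefficients gives the recursion for `c_α(r)` (`sum_pow_eq`).

Matrix identity. `S + S†` and `S† - S` have the desired off-diagonals, apart from wrap-around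
entries in the two corners. The matrix `(X^{⊗n} + C_n^-) / 2` consists of exactly these corners, and
`I^{⊗(n-1)} ⊗ Z` gives its first and last rows opposite signs. This corrects both operators.

Circuits. Only `S_n` and `-C_n^-` are not tensor products. To increment, the register is split into
halves, each serving as borrowed workspace for the other: subtracting `g + b` and adding `g + b'`
changes a register by `b' - b`, whatever `g` is (`run_controlledIncrement`), and the carry into the
upper half is a multiply controlled NOT on borrowed wires (`run_borrowedNot`). Incrementing controls
and target together, then decrementing the controls, gives a multiply controlled NOT with a single
borrowed wire (`run_multiNot`). Finally `-C_n^-` is `X^{⊗n}` after a phase flip on the all-zero and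
all-one states, that is, a multiply controlled `Z` up to a linear change of bits. Unitarity is
inherited from the circuits. One qubit is treated separately to save a `Z` gate. -/

/-- The eigenvalue `(-1)^b` of `Z` at the basis state `b`. -/
def sign (b : Fin 2) : ℝ := if b = 0 then 1 else -1

theorem sign_mul_self (b : Fin 2) : sign b * sign b = 1 := by
  unfold sign; split_ifs <;> norm_num

theorem pauliZ_eq_diagonal : pauliZ = diagonal fun b => ((sign b : ℝ) : ℂ) := by
  ext a b
  fin_cases a <;> fin_cases b <;> simp [pauliZ, sign]

theorem tensor_diagonal {n : ℕ} (d : Fin n → Fin 2 → ℂ) :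
    tensor (fun q => diagonal (d q)) = diagonal fun i => ∏ q, d q (bits n i q) := by
  ext i j
  by_cases h : i = j
  · subst h; simp [tensor]
  · have : bits n i ≠ bits n j := fun e => h ((bits n).injective e)
    obtain ⟨q, hq⟩ := Function.ne_iff.mp this
    rw [diagonal_apply_ne _ h]
    exact Finset.prod_eq_zero (Finset.mem_univ q) (diagonal_apply_ne _ hq)

/-- The diagonal entry of `Z_α` at the row `i`. -/
def character {n : ℕ} (α : Finset (Fin n)) (i : Fin (2 ^ n)) : ℝ := ∏ q ∈ α, sign (bits n i q)

theorem zString_eq_diagonal {n : ℕ} (α : Finset (Fin n)) :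
    zString α = diagonal fun i => ((character α i : ℝ) : ℂ) := by
  have : (fun q => if q ∈ α then pauliZ else 1) =
      fun q : Fin n => diagonal fun b => if q ∈ α then ((sign b : ℝ) : ℂ) else 1 := by
    funext q
    by_cases h : q ∈ α
    · simp [h, pauliZ_eq_diagonal]
    · simp only [h, if_false]; exact (diagonal_one).symm
  rw [zString, this, tensor_diagonal]
  congr 1; funext i
  rw [character, Complex.ofReal_prod, Finset.prod_ite_mem, Finset.univ_inter]

theorem val_eq_sum_bits (n : ℕ) (i : Fin (2 ^ n)) :
    i.val = ∑ q : Fin n, (bits n i q.rev).val * 2 ^ q.val := by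
  conv_lhs => rw [← finFunctionFinEquiv.apply_symm_apply i]
  rw [finFunctionFinEquiv_apply]
  simp [bits, Equiv.arrowCongr]

/-- Each digit `b` equals `(1 - sign b) / 2`, and the constant parts add up to `(2^n - 1) / 2`; with
the shift by one row this leaves the constant `1 / 2`. -/
theorem gridPoint_eq (n : ℕ) (i : Fin (2 ^ n)) :
    gridPoint n i = (1 + ∑ q, qubitWeight n q * sign (bits n i q)) / 2 := by
  have hs (b : Fin 2) : sign b = 1 - 2 * (b.val : ℝ) := by
    fin_cases b <;> norm_num [sign]
  have hg : ∑ q : Fin n, (2 : ℝ) ^ q.val = 2 ^ n - 1 := by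
    rw [Fin.sum_univ_eq_sum_range (fun q => (2 : ℝ) ^ q), geom_sum_eq (by norm_num)]
    norm_num
  have hN : (2 : ℝ) ^ n + 1 ≠ 0 := by positivity
  have hv : (i.val : ℝ) = ∑ q : Fin n, ((bits n i q.rev).val : ℝ) * 2 ^ q.val := by
    exact_mod_cast val_eq_sum_bits n i
  -- Qubits are numbered from the most significant end, so the reversed index `q` has place value `2
  -- ^ q`.
  have hw (q : Fin n) : qubitWeight n q.rev = -(2 ^ q.val / (2 ^ n + 1)) := by
    have h1 : (2 : ℝ) ^ n = 2 ^ q.val * 2 ^ ((q.rev).val + 1) := by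
      rw [← pow_add]; congr 1; rw [Fin.val_rev]; omega
    rw [qubitWeight]
    have h2 : (2 : ℝ) ^ ((q.rev).val + 1) ≠ 0 := by positivity
    field_simp
    linarith
  rw [← Equiv.sum_comp Fin.revPerm]
  simp only [Fin.revPerm_apply, hw, hs]
  have : ∑ q : Fin n, -((2 : ℝ) ^ q.val / (2 ^ n + 1)) * (1 - 2 * ((bits n i q.rev).val : ℝ))
      = (-(2 ^ n - 1) + 2 * (i.val : ℝ)) / (2 ^ n + 1) := by
    rw [hv, ← hg, ← Finset.sum_neg_distrib, Finset.mul_sum, ← Finset.sum_add_distrib,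
      Finset.sum_div]
    refine Finset.sum_congr rfl fun q _ => ?_
    field_simp
    ring
  rw [this, gridPoint, step]
  field_simp
  ring

theorem recCoeff_eq_zero (n : ℕ) : ∀ (r : ℕ) (α : Finset (Fin n)), r < α.card → recCoeff n r α = 0
  | 0, α, h => by
    have : α ≠ ∅ := by rintro rfl; simp at h
    simp [recCoeff, this]
  | r + 1, α, h => by simp [recCoeff, h]

theorem recCoeff_card (n r : ℕ) (α : Finset (Fin n)) (h : α.card = r) :
    recCoeff n r α = (r.factorial : ℝ) := by
  cases r with
  | zero => simp [recCoeff, Finset.card_eq_zero.mp h]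
  | succ r => simp [recCoeff, h]

/-- The case distinction in the definition is redundant: above level `r + 1` all summands vanish,
and at level `r + 1` only the `r + 1` erasures survive, each contributing `r!`. -/
theorem recCoeff_succ (n r : ℕ) (α : Finset (Fin n)) :
    recCoeff n (r + 1) α = recCoeff n r α + ∑ l ∈ α, recCoeff n r (α.erase l)
      + ∑ l ∈ αᶜ, qubitWeight n l ^ 2 * recCoeff n r (insert l α) := by
  have hins (hr : r < α.card) :
      ∑ l ∈ αᶜ, qubitWeight n l ^ 2 * recCoeff n r (insert l α) = 0 := by
    refine Finset.sum_eq_zero fun l hl => ?_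
    rw [recCoeff_eq_zero, mul_zero]
    rw [Finset.card_insert_of_notMem (by simpa using hl)]; omega
  rcases lt_trichotomy (r + 1) α.card with h | h | h
  · rw [recCoeff_eq_zero n _ _ h, recCoeff_eq_zero n _ _ (by omega), hins (by omega)]
    rw [Finset.sum_eq_zero]
    · simp
    · intro l hl
      apply recCoeff_eq_zero
      rw [Finset.card_erase_of_mem hl]; omega
  · rw [recCoeff_card n _ _ h.symm, recCoeff_eq_zero n r α (by omega), hins (by omega)]
    have : ∑ l ∈ α, recCoeff n r (α.erase l) = ∑ l ∈ α, (r.factorial : ℝ) := by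
      refine Finset.sum_congr rfl fun l hl => recCoeff_card _ _ _ ?_
      rw [Finset.card_erase_of_mem hl]; omega
    rw [this, Finset.sum_const, ← h, Nat.factorial_succ]
    simp
  · rw [recCoeff, if_neg (by omega), if_neg (by omega)]

theorem stringWeight_mul_character_insert {n : ℕ} {α : Finset (Fin n)} {l : Fin n} (hl : l ∉ α)
    (i : Fin (2 ^ n)) :
    stringWeight (insert l α) * character (insert l α) i =
      qubitWeight n l * sign (bits n i l) * (stringWeight α * character α i) := by
  rw [stringWeight, character, Finset.prod_insert hl, Finset.prod_insert hl]
  simp only [stringWeight, character]; ring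

/-- Adding or removing `l` is an involution on the pairs of an index and a set. -/
theorem sum_mem_erase {n : ℕ} (f : Fin n → Finset (Fin n) → ℝ) :
    ∑ α : Finset (Fin n), ∑ l ∈ α, f l (α.erase l) = ∑ α : Finset (Fin n), ∑ l ∈ αᶜ, f l α := by
  rw [Finset.sum_sigma', Finset.sum_sigma']
  refine Finset.sum_bij' (fun x _ => ⟨x.1.erase x.2, x.2⟩) (fun x _ => ⟨insert x.2 x.1, x.2⟩)
    ?_ ?_ ?_ ?_ ?_
  · rintro ⟨α, l⟩ h; simp
  · rintro ⟨α, l⟩ h; simp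
  · rintro ⟨α, l⟩ h
    simp at h; simp [Finset.insert_erase h]
  · rintro ⟨α, l⟩ h
    simp at h; simp [Finset.erase_insert h]
  · rintro ⟨α, l⟩ h; rfl

theorem sum_pow_eq (n r : ℕ) (i : Fin (2 ^ n)) :
    (1 + ∑ q, qubitWeight n q * sign (bits n i q)) ^ r =
      ∑ α : Finset (Fin n), recCoeff n r α * (stringWeight α * character α i) := by
  induction r with
  | zero => simp [recCoeff, stringWeight, character]
  | succ r ih =>
    set t : Finset (Fin n) → ℝ := fun α => stringWeight α * character α i with ht
    have hin {α : Finset (Fin n)} {l : Fin n} (hl : l ∉ α) :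
        t (insert l α) = qubitWeight n l * sign (bits n i l) * t α :=
      stringWeight_mul_character_insert hl i
    -- One more factor either removes `l` from `α`, at the cost of `c_l ^ 2`, or inserts it.
    have hsplit : ∀ α : Finset (Fin n), ∑ q, qubitWeight n q * sign (bits n i q) * t α =
        ∑ l ∈ α, qubitWeight n l ^ 2 * t (α.erase l) + ∑ l ∈ αᶜ, t (insert l α) := by
      intro α
      rw [← Finset.sum_add_sum_compl α]
      congr 1
      · refine Finset.sum_congr rfl fun l hl => ?_
        conv_lhs => rw [← Finset.insert_erase hl, hin (Finset.notMem_erase l α)]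
        linear_combination qubitWeight n l ^ 2 * t (α.erase l) * sign_mul_self (bits n i l)
      · refine Finset.sum_congr rfl fun l hl => (hin (by simpa using hl)).symm
    rw [pow_succ, ih, Finset.sum_mul]
    simp only [recCoeff_succ, add_mul, Finset.sum_add_distrib]
    -- Reindexing moves the shift of the set from the coefficient to the monomial, where `hsplit`
    -- applies; `h2` does the same in the other direction.
    have h1 : ∑ α : Finset (Fin n), (∑ l ∈ α, recCoeff n r (α.erase l)) * t α =
        ∑ α : Finset (Fin n), ∑ l ∈ αᶜ, recCoeff n r α * t (insert l α) := by
      rw [← sum_mem_erase (fun l α => recCoeff n r α * t (insert l α))]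
      refine Finset.sum_congr rfl fun α _ => ?_
      rw [Finset.sum_mul]
      refine Finset.sum_congr rfl fun l hl => ?_
      rw [Finset.insert_erase hl]
    have h2 : ∑ α : Finset (Fin n),
          (∑ l ∈ αᶜ, qubitWeight n l ^ 2 * recCoeff n r (insert l α)) * t α =
        ∑ α : Finset (Fin n), ∑ l ∈ α, recCoeff n r α * (qubitWeight n l ^ 2 * t (α.erase l)) := by
      have := sum_mem_erase
        (fun l α => recCoeff n r (insert l α) * (qubitWeight n l ^ 2 * t α))
      calc _ = ∑ α : Finset (Fin n), ∑ l ∈ αᶜ,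
            recCoeff n r (insert l α) * (qubitWeight n l ^ 2 * t α) := by
            refine Finset.sum_congr rfl fun α _ => ?_
            rw [Finset.sum_mul]
            exact Finset.sum_congr rfl fun l _ => by ring
        _ = _ := by
            rw [← this]
            refine Finset.sum_congr rfl fun α _ => Finset.sum_congr rfl fun l hl => ?_
            rw [Finset.insert_erase hl]
    rw [h1, h2]
    rw [← Finset.sum_add_distrib, ← Finset.sum_add_distrib]
    refine Finset.sum_congr rfl fun α _ => ?_
    have := hsplit α
    rw [← Finset.sum_mul] at this
    rw [mul_assoc, mul_comm (stringWeight α * character α i), add_mul, one_mul]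
    change recCoeff n r α * (t α + _ * t α) = recCoeff n r α * t α + _ + _
    rw [this, ← Finset.mul_sum, ← Finset.mul_sum]
    ring

theorem eval_gridPoint {n k : ℕ} {p : ℝ[X]} (hp : p.natDegree ≤ k) (i : Fin (2 ^ n)) :
    p.eval (gridPoint n i) = ∑ α : LowWeight n k, polyCoeff k p α.1 * character α.1 i := by
  have hres : ∑ α : LowWeight n k, polyCoeff k p α.1 * character α.1 i =
      ∑ α : Finset (Fin n), polyCoeff k p α * character α i := by
    rw [← Finset.sum_subtype (Finset.univ.filter fun α : Finset (Fin n) => α.card ≤ k) (by simp)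
      fun α => polyCoeff k p α * character α i]
    refine Finset.sum_subset (Finset.filter_subset _ _) fun α _ h => ?_
    have : k < α.card := by simpa using h
    simp [polyCoeff, Finset.Icc_eq_empty_of_lt this]
  rw [hres, eval_eq_sum_range' (Nat.lt_succ_of_le hp)]
  have hc (α : Finset (Fin n)) : polyCoeff k p α * character α i =
      ∑ j ∈ Finset.range (k + 1),
        p.coeff j * (1 / 2 ^ j) * (recCoeff n j α * (stringWeight α * character α i)) := by
    rw [polyCoeff, mul_assoc, Finset.sum_mul]
    have : Finset.Icc α.card k ⊆ Finset.range (k + 1) := fun j hj => by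
      simp at hj ⊢; omega
    rw [← Finset.sum_subset this]
    · exact Finset.sum_congr rfl fun j _ => by ring
    · intro j hj hj'
      rw [recCoeff_eq_zero]
      · ring
      · simp at hj hj'; omega
  simp only [hc]
  rw [Finset.sum_comm]
  refine Finset.sum_congr rfl fun j _ => ?_
  rw [← Finset.mul_sum, ← sum_pow_eq, gridPoint_eq, div_pow]
  ring

theorem gridDiagonal_eq_sum {n k : ℕ} {p : ℝ[X]} (hp : p.natDegree ≤ k) :
    gridDiagonal n p = ∑ α : LowWeight n k, ((polyCoeff k p α.1 : ℝ) : ℂ) • zString α.1 := by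
  ext i j
  rw [Matrix.sum_apply]
  simp only [zString_eq_diagonal, Matrix.smul_apply, gridDiagonal]
  by_cases h : i = j
  · subst h
    simp only [diagonal_apply_eq, eval_gridPoint hp, smul_eq_mul]
    push_cast; rfl
  · simp [diagonal_apply_ne _ h]

/-! ### The linear combination -/

theorem pauliX_apply (a b : Fin 2) : pauliX a b = if a = b + 1 then 1 else 0 := by
  fin_cases a <;> fin_cases b <;> simp [pauliX]

/-- The antidiagonal pairs each row with its bitwise complement, because a number and its complement
sum to `2^n - 1`. -/
theorem add_one_iff_bits {n : ℕ} (i j : Fin (2 ^ n)) :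
    i.val + j.val + 1 = 2 ^ n ↔ ∀ q, bits n i q = bits n j q + 1 := by
  have key : ∀ j : Fin (2 ^ n), ∀ i : Fin (2 ^ n), (∀ q, bits n i q = bits n j q + 1) →
      i.val + j.val + 1 = 2 ^ n := by
    intro j i h
    rw [val_eq_sum_bits n i, val_eq_sum_bits n j, ← Finset.sum_add_distrib]
    have : ∀ q : Fin n, (bits n i q.rev).val * 2 ^ q.val + (bits n j q.rev).val * 2 ^ q.val
        = 2 ^ q.val := by
      intro q
      rw [h, ← add_mul]
      generalize bits n j q.rev = b
      fin_cases b <;> simp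
    simp only [this]
    rw [Fin.sum_univ_eq_sum_range (fun q => 2 ^ q), Nat.geomSum_eq le_rfl]
    have := Nat.one_le_two_pow (n := n)
    simp; omega
  refine ⟨fun h => ?_, key j i⟩
  -- Since `i` is determined by `j` and the sum, it must be the complement of `j`.
  have := key j ((bits n).symm fun q => bits n j q + 1) (by simp)
  have : i = (bits n).symm fun q => bits n j q + 1 := Fin.ext (by omega)
  simp [this]

theorem xAll_apply {n : ℕ} (i j : Fin (2 ^ n)) :
    xAll n i j = if i.val + j.val + 1 = 2 ^ n then 1 else 0 := by
  simp only [xAll, tensor, of_apply, pauliX_apply, add_one_iff_bits]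
  rw [Finset.prod_ite_zero]
  simp

theorem bits_last {n : ℕ} (i : Fin (2 ^ (n + 1))) :
    (bits (n + 1) i (Fin.last n)).val = i.val % 2 := by
  rw [val_eq_sum_bits (n + 1) i, Fin.sum_univ_succ]
  have : ∑ q : Fin n, (bits (n + 1) i q.succ.rev).val * 2 ^ q.succ.val =
      2 * ∑ q : Fin n, (bits (n + 1) i q.succ.rev).val * 2 ^ q.val := by
    rw [Finset.mul_sum]
    exact Finset.sum_congr rfl fun q _ => by rw [Fin.val_succ, pow_succ 2 q.val]; ring
  rw [this]
  simp only [Fin.rev_zero, Fin.val_zero, pow_zero, mul_one, Nat.add_mul_mod_self_left]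
  exact (Nat.mod_eq_of_lt (Fin.isLt _)).symm

theorem zLast_succ (n : ℕ) : zLast (n + 1) = zString {Fin.last n} := by
  rw [zLast, zString]
  congr 1; funext q
  simp [Fin.ext_iff]

theorem zLast_mul_apply {n : ℕ} (hn : 0 < n) (M : Matrix (Fin (2 ^ n)) (Fin (2 ^ n)) ℂ)
    (i j : Fin (2 ^ n)) : (zLast n * M) i j = (if i.val % 2 = 0 then 1 else -1) * M i j := by
  obtain ⟨n, rfl⟩ := Nat.exists_eq_succ_of_ne_zero hn.ne'
  rw [zLast_succ, zString_eq_diagonal, diagonal_mul, character, Finset.prod_singleton, sign,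
    ← bits_last]
  congr 1
  generalize bits (n + 1) i (Fin.last n) = b
  fin_cases b <;> simp

theorem normalizedLaplacian_eq (n : ℕ) (hn : 0 < n) : normalizedLaplacian n =
    (-2 : ℂ) • (1 : Matrix (Fin (2 ^ n)) (Fin (2 ^ n)) ℂ) + increment n + (increment n)ᴴ
      + (-1 / 2 : ℂ) • xAll n + (1 / 2 : ℂ) • (-cMinus n) := by
  have hs : ((step n ^ 2 : ℝ) : ℂ) * ((1 / step n ^ 2 : ℝ) : ℂ) = 1 := by
    rw [← Complex.ofReal_mul, mul_one_div_cancel, Complex.ofReal_one]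
    have : 0 < step n := by unfold step; positivity
    positivity
  have h2 : 2 ≤ 2 ^ n := by
    calc 2 = 2 ^ 1 := rfl
      _ ≤ 2 ^ n := Nat.pow_le_pow_right (by norm_num) hn
  ext i j
  rw [normalizedLaplacian, dirichletLaplacian, smul_smul, hs, one_smul]
  simp only [Matrix.add_apply, Matrix.smul_apply, Matrix.neg_apply, Matrix.one_apply, xAll_apply,
    increment, cMinus, conjTranspose_apply, of_apply, smul_eq_mul, Fin.ext_iff]
  have hi := i.2
  have hj := j.2
  have e1 : (j.val + 1) % 2 ^ n = if j.val + 1 = 2 ^ n then 0 else j.val + 1 := by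
    split_ifs with h
    · rw [h, Nat.mod_self]
    · exact Nat.mod_eq_of_lt (by omega)
  have e2 : (i.val + 1) % 2 ^ n = if i.val + 1 = 2 ^ n then 0 else i.val + 1 := by
    split_ifs with h
    · rw [h, Nat.mod_self]
    · exact Nat.mod_eq_of_lt (by omega)
  rw [e1, e2]
  generalize 2 ^ n = N at *
  generalize i.val = a at *
  generalize j.val = b at *
  split_ifs <;> first | omega | norm_num

theorem centralDifference_eq (n : ℕ) (hn : 0 < n) :
    ((step n ^ 2 : ℝ) : ℂ) • centralDifference n = ((step n / 2 : ℝ) : ℂ) •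
      ((increment n)ᴴ - increment n + (1 / 2 : ℂ) • (zLast n * xAll n)
        - (1 / 2 : ℂ) • (zLast n * -cMinus n)) := by
  have hs : ((step n ^ 2 : ℝ) : ℂ) * ((1 / (2 * step n) : ℝ) : ℂ) = ((step n / 2 : ℝ) : ℂ) := by
    rw [← Complex.ofReal_mul]
    congr 1
    have : 0 < step n := by unfold step; positivity
    field_simp
  -- Evenness of `2^n` makes the last row index odd, so `Z` on the last qubit negates the lower
  -- corner but not the upper one.
  have h2 : 2 ∣ 2 ^ n := dvd_pow_self 2 hn.ne'
  rw [centralDifference, smul_smul, hs]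
  congr 1
  ext i j
  simp only [Matrix.add_apply, Matrix.sub_apply, Matrix.smul_apply, zLast_mul_apply hn,
    Matrix.neg_apply, xAll_apply,
    increment, cMinus, conjTranspose_apply, of_apply, smul_eq_mul]
  have hi := i.2
  have hj := j.2
  have e1 : (j.val + 1) % 2 ^ n = if j.val + 1 = 2 ^ n then 0 else j.val + 1 := by
    split_ifs with h
    · rw [h, Nat.mod_self]
    · exact Nat.mod_eq_of_lt (by omega)
  have e2 : (i.val + 1) % 2 ^ n = if i.val + 1 = 2 ^ n then 0 else i.val + 1 := by
    split_ifs with h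
    · rw [h, Nat.mod_self]
    · exact Nat.mod_eq_of_lt (by omega)
  rw [e1, e2]
  generalize 2 ^ n = N at *
  generalize i.val = a at *
  generalize j.val = b at *
  split_ifs <;> first | omega | norm_num

theorem linear_combination_eq {n k : ℕ} (hn : 0 < n) {p : ℝ[X]} (hp : p.natDegree ≤ k) :
    normalizedLaplacian n + ((step n ^ 2 : ℝ) : ℂ) • (gridDiagonal n p * centralDifference n) =
      ∑ l : TermIndex n k, ((lcuCoeff n k p l : ℝ) : ℂ) • lcuTerm n k l := by
  rw [Fintype.sum_sum_type, Fintype.sum_prod_type, normalizedLaplacian_eq n hn]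
  congr 1
  · simp [Fin.sum_univ_five, lcuCoeff, lcuTerm]
    module
  · rw [← Matrix.mul_smul, centralDifference_eq n hn, gridDiagonal_eq_sum hp, Finset.sum_mul]
    refine Finset.sum_congr rfl fun α _ => ?_
    simp only [Fin.sum_univ_four, lcuCoeff, lcuTerm]
    simp [mul_add, mul_sub, smul_smul, smul_add, smul_sub]
    module

/-! ### Counting the terms -/

theorem card_lowWeight_le {n k : ℕ} (h : 2 * k < n) : Fintype.card (LowWeight n k) ≤ 2 * n ^ k := by
  have h1 : Fintype.card (LowWeight n k) ≤ ∑ j ∈ Finset.range (k + 1), n ^ j := by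
    rw [Fintype.card_subtype]
    have : (Finset.univ.filter fun α : Finset (Fin n) => α.card ≤ k) =
        (Finset.range (k + 1)).biUnion fun j => Finset.powersetCard j Finset.univ := by
      ext α; simp [Finset.mem_powersetCard]
    rw [this]
    refine Finset.card_biUnion_le.trans (Finset.sum_le_sum fun j _ => ?_)
    rw [Finset.card_powersetCard, Finset.card_univ, Fintype.card_fin]
    exact Nat.choose_le_pow n j
  refine h1.trans ?_
  -- The geometric bound needs a ratio of at least `2`; when `n = 1` the assumption `2 * k < n`
  -- forces `k = 0`.
  have h2 : ∀ m, m = 0 ∨ 2 ≤ n → ∑ j ∈ Finset.range (m + 1), n ^ j ≤ 2 * n ^ m := by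
    intro m
    induction m with
    | zero => simp
    | succ m ih =>
      intro hm
      have hn : 2 ≤ n := by omega
      rw [Finset.sum_range_succ]
      have := ih (Or.inr hn)
      have h3 : n ^ (m + 1) = n ^ m * n := pow_succ n m
      nlinarith [Nat.mul_le_mul_left (n ^ m) hn]
  exact h2 k (by omega)

theorem card_termIndex_le {n k : ℕ} (h : 2 * k < n) :
    Fintype.card (TermIndex n k) ≤ 13 * n ^ k := by
  rw [Fintype.card_sum, Fintype.card_prod, Fintype.card_fin, Fintype.card_fin]
  have h1 := card_lowWeight_le h
  have h2 : 1 ≤ n ^ k := Nat.one_le_pow _ _ (by omega)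
  omega

/-! ### Classical circuits -/

section Classical

variable {N : ℕ}

/-- The action of a classical gate on basis states; other gates are ignored. -/
def Gate.act : Gate N → (Fin N → Fin 2) → (Fin N → Fin 2)
  | .x q, s => Function.update s q (s q + 1)
  | .cnot c t _, s => Function.update s t (s t + s c)
  | .toffoli c d t _ _ _, s => Function.update s t (s t + s c * s d)
  | _, s => s

/-- The action of a classical circuit on basis states. -/
def run (G : Circuit N) (s : Fin N → Fin 2) : Fin N → Fin 2 := G.foldr Gate.act s

/-- All gates of the circuit are Toffoli, `X` or `CNOT` gates. -/
def IsClassical (G : Circuit N) : Prop := ∀ g ∈ G, g.isClassical = true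

theorem run_nil (s : Fin N → Fin 2) : run [] s = s := rfl

theorem run_cons (g : Gate N) (G : Circuit N) (s : Fin N → Fin 2) :
    run (g :: G) s = g.act (run G s) := rfl

theorem run_append (G H : Circuit N) (s : Fin N → Fin 2) : run (G ++ H) s = run G (run H s) := by
  simp [run]

theorem fin_two_add_add (a b : Fin 2) : a + b + b = a := by revert a b; decide

theorem Gate.act_act (g : Gate N) (s : Fin N → Fin 2) : g.act (g.act s) = s := by
  cases g with
  | had q => rfl
  | z q => rfl
  | x q => simp [Gate.act, fin_two_add_add]
  | cnot c t h => simp [Gate.act, Function.update_of_ne h, fin_two_add_add]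
  | toffoli c d t h1 h2 h3 =>
    simp [Gate.act, Function.update_of_ne h2, Function.update_of_ne h3, fin_two_add_add]

theorem run_reverse_run (G : Circuit N) (s : Fin N → Fin 2) : run G.reverse (run G s) = s := by
  induction G with
  | nil => rfl
  | cons g G ih =>
    rw [List.reverse_cons, run_append, run_cons, run_cons, run_nil, Gate.act_act, ih]

theorem run_run_reverse (G : Circuit N) (s : Fin N → Fin 2) : run G (run G.reverse s) = s := by
  simpa using run_reverse_run G.reverse s

theorem isClassical_append {G H : Circuit N} (hG : IsClassical G) (hH : IsClassical H) :
    IsClassical (G ++ H) := by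
  intro g hg
  rcases List.mem_append.mp hg with h | h
  exacts [hG g h, hH g h]

theorem isClassical_reverse {G : Circuit N} (hG : IsClassical G) : IsClassical G.reverse :=
  fun g hg => hG g (List.mem_reverse.mp hg)

/-- The `CNOT` gate, or nothing if the wires coincide. -/
def cx (c t : Fin N) : Circuit N := if h : c ≠ t then [.cnot c t h] else []

/-- The Toffoli gate, or nothing if two of the wires coincide. -/
def ccx (c d t : Fin N) : Circuit N :=
  if h : c ≠ d ∧ c ≠ t ∧ d ≠ t then [.toffoli c d t h.1 h.2.1 h.2.2] else []

theorem run_x (q : Fin N) (s : Fin N → Fin 2) :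
    run [.x q] s = Function.update s q (s q + 1) := rfl

theorem run_cx {c t : Fin N} (h : c ≠ t) (s : Fin N → Fin 2) :
    run (cx c t) s = Function.update s t (s t + s c) := by
  simp [cx, h, run, Gate.act]

theorem run_ccx {c d t : Fin N} (h1 : c ≠ d) (h2 : c ≠ t) (h3 : d ≠ t) (s : Fin N → Fin 2) :
    run (ccx c d t) s = Function.update s t (s t + s c * s d) := by
  simp [ccx, h1, h2, h3, run, Gate.act]

theorem isClassical_x (q : Fin N) : IsClassical [.x q] := by simp [IsClassical, Gate.isClassical]

theorem isClassical_cx (c t : Fin N) : IsClassical (cx c t) := by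
  unfold cx; split_ifs <;> simp [IsClassical, Gate.isClassical]

theorem isClassical_ccx (c d t : Fin N) : IsClassical (ccx c d t) := by
  unfold ccx; split_ifs <;> simp [IsClassical, Gate.isClassical]

theorem length_cx_le (c t : Fin N) : (cx c t).length ≤ 1 := by
  unfold cx; split_ifs <;> simp

theorem length_ccx_le (c d t : Fin N) : (ccx c d t).length ≤ 1 := by
  unfold ccx; split_ifs <;> simp

theorem reverse_cx (c t : Fin N) : (cx c t).reverse = cx c t := by
  unfold cx; split_ifs <;> simp

theorem reverse_ccx (c d t : Fin N) : (ccx c d t).reverse = ccx c d t := by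
  unfold ccx; split_ifs <;> simp

/-! ### Registers -/

/-- The number held by a list of wires, least significant bit first. -/
def val : List (Fin N) → (Fin N → Fin 2) → ℕ
  | [], _ => 0
  | w :: ws, s => (s w).val + 2 * val ws s

/-- The conjunction of the bits on a list of wires. -/
def conj : List (Fin N) → (Fin N → Fin 2) → Fin 2
  | [], _ => 1
  | w :: ws, s => s w * conj ws s

theorem val_congr {s s' : Fin N → Fin 2} : ∀ {ws : List (Fin N)}, (∀ w ∈ ws, s w = s' w) →
    val ws s = val ws s'
  | [], _ => rfl
  | w :: ws, h => by
    rw [val, val, h w (by simp), val_congr fun v hv => h v (by simp [hv])]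

theorem conj_congr {s s' : Fin N → Fin 2} : ∀ {ws : List (Fin N)}, (∀ w ∈ ws, s w = s' w) →
    conj ws s = conj ws s'
  | [], _ => rfl
  | w :: ws, h => by
    rw [conj, conj, h w (by simp), conj_congr fun v hv => h v (by simp [hv])]

theorem val_lt (s : Fin N → Fin 2) : ∀ ws : List (Fin N), val ws s < 2 ^ ws.length
  | [] => by simp [val]
  | w :: ws => by
    have := val_lt s ws
    have := (s w).isLt
    rw [val, List.length_cons, pow_succ]; omega

theorem eq_of_val_eq {s s' : Fin N → Fin 2} : ∀ {ws : List (Fin N)}, val ws s = val ws s' →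
    ∀ w ∈ ws, s w = s' w
  | [], _ => by simp
  | v :: ws, h => by
    rw [val, val] at h
    have h1 := (s v).isLt
    have h2 := (s' v).isLt
    have h3 : (s v).val = (s' v).val := by omega
    have h4 : val ws s = val ws s' := by omega
    intro w hw
    rcases List.mem_cons.mp hw with rfl | hw
    · exact Fin.ext h3
    · exact eq_of_val_eq h4 w hw

theorem val_append (s : Fin N → Fin 2) : ∀ ws vs : List (Fin N),
    val (ws ++ vs) s = val ws s + 2 ^ ws.length * val vs s
  | [], vs => by simp [val]
  | w :: ws, vs => by
    rw [List.cons_append, val, val, val_append s ws vs, List.length_cons, pow_succ]; ring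

theorem conj_eq_one_iff (s : Fin N → Fin 2) : ∀ ws : List (Fin N),
    conj ws s = 1 ↔ val ws s + 1 = 2 ^ ws.length
  | [] => by simp [conj, val]
  | w :: ws => by
    have ih := conj_eq_one_iff s ws
    have hlt := val_lt s ws
    rw [conj, val, List.length_cons, pow_succ]
    have : ∀ a b : Fin 2, a * b = 1 ↔ a.val = 1 ∧ b = 1 := by decide
    rw [this, ih]
    have := (s w).isLt
    omega

theorem conj_eq_one_iff_forall (s : Fin N → Fin 2) : ∀ ws : List (Fin N),
    conj ws s = 1 ↔ ∀ w ∈ ws, s w = 1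
  | [] => by simp [conj]
  | w :: ws => by
    have : ∀ a b : Fin 2, a * b = 1 ↔ a = 1 ∧ b = 1 := by decide
    rw [conj, this, conj_eq_one_iff_forall s ws]
    simp

/-! ### Multiply controlled gates with many borrowed wires -/

/-- Adds the conjunction of the wires `xs` to the wire `d`, but also modifies the wires `ds`. -/
def ladder : List (Fin N) → List (Fin N) → Fin N → Circuit N
  | [], _, d => [.x d]
  | x :: _, [], d => cx x d
  | x :: xs, d' :: ds, d => ccx x d' d ++ ladder xs ds d' ++ ccx x d' d

/-- Adds the conjunction of the wires `xs` to the wire `t` and borrows the wires `ds`. -/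
def borrowedNot : List (Fin N) → List (Fin N) → Fin N → Circuit N
  | [], _, t => [.x t]
  | x :: _, [], t => cx x t
  | x :: xs, d :: ds, t => ccx x d t ++ ladder xs ds d ++ ccx x d t ++ ladder xs ds d

theorem reverse_ladder : ∀ (xs ds : List (Fin N)) (d : Fin N),
    (ladder xs ds d).reverse = ladder xs ds d
  | [], _, d => by simp [ladder]
  | x :: _, [], d => by simp [ladder, reverse_cx]
  | x :: xs, d' :: ds, d => by
    simp [ladder, reverse_ccx, reverse_ladder xs ds d']

/-- The wire `d` receives `x * d'` before, and `x * (d' + conj xs)` after, the shorter ladder has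
acted on `d'`. The unknown value of `d'` cancels modulo two. -/
theorem run_ladder : ∀ {xs ds : List (Fin N)} {d : Fin N}, (d :: (xs ++ ds)).Nodup →
    xs.length ≤ ds.length + 1 → ∀ s : Fin N → Fin 2,
    run (ladder xs ds d) s d = s d + conj xs s ∧
      ∀ w, w ∉ d :: ds → run (ladder xs ds d) s w = s w
  | [], ds, d, _, _, s => by
    simp only [ladder, run_x, conj]
    refine ⟨by simp, fun w hw => ?_⟩
    rw [Function.update_of_ne]; rintro rfl; simp at hw
  | [x], [], d, hn, _, s => by
    have hxd : x ≠ d := by rintro rfl; simp at hn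
    simp only [ladder, run_cx hxd, conj]
    refine ⟨by simp, fun w hw => ?_⟩
    rw [Function.update_of_ne]; rintro rfl; simp at hw
  | x :: y :: xs, [], d, _, hl, s => by simp at hl
  | x :: xs, d' :: ds, d, hn, hl, s => by
    have hn' : (d' :: (xs ++ ds)).Nodup := by
      rw [← List.nodup_middle (l₁ := xs)]
      exact ((List.nodup_cons.mp (List.nodup_cons.mp hn).2)).2
    simp only [List.cons_append, List.nodup_cons, List.mem_cons, List.mem_append, not_or] at hn
    obtain ⟨⟨hdx, hdxs, hdd', hdds⟩, ⟨hxxs, hxd', hxds⟩, hn2⟩ := hn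
    have ih := run_ladder hn' (by simpa using hl)
    simp only [ladder, run_append, run_ccx hxd' (Ne.symm hdx) (Ne.symm hdd')]
    set s1 := Function.update s d (s d + s x * s d') with hs1
    obtain ⟨ih1, ih2⟩ := ih s1
    have e1 : run (ladder xs ds d') s1 d = s d + s x * s d' := by
      rw [ih2 d (by simp [hdd', hdds]), hs1, Function.update_self]
    have e2 : run (ladder xs ds d') s1 x = s x := by
      rw [ih2 x (by simp [hxd', hxds]), hs1, Function.update_of_ne (Ne.symm hdx)]
    have e3 : conj xs s1 = conj xs s := conj_congr fun w hw => by
      rw [hs1, Function.update_of_ne]; rintro rfl; exact hdxs hw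
    have e4 : s1 d' = s d' := by rw [hs1, Function.update_of_ne (Ne.symm hdd')]
    refine ⟨?_, fun w hw => ?_⟩
    · rw [Function.update_self, e1, e2, ih1, e3, e4, conj]
      generalize s d = a
      generalize s x = b
      generalize s d' = c
      generalize conj xs s = e
      revert a b c e; decide
    · simp only [List.mem_cons, not_or] at hw
      rw [Function.update_of_ne hw.1, ih2 w (by simp [hw]), hs1, Function.update_of_ne hw.1]

/-- The target of `borrowedNot` is a spectator of the ladder, so its change can be carried past the
second ladder, which then undoes the first. -/
theorem run_ladder_update : ∀ {xs ds : List (Fin N)} {d : Fin N}, (d :: (xs ++ ds)).Nodup →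
    ∀ {t : Fin N}, t ∉ d :: (xs ++ ds) → ∀ (s : Fin N → Fin 2) (v : Fin 2),
    run (ladder xs ds d) (Function.update s t v) = Function.update (run (ladder xs ds d) s) t v
  | [], ds, d, _, t, ht, s, v => by
    have h : t ≠ d := by rintro rfl; simp at ht
    simp only [ladder, run_x]
    rw [Function.update_of_ne h.symm, Function.update_comm h]
  | x :: xs, [], d, hn, t, ht, s, v => by
    have hxd : x ≠ d := by rintro rfl; simp at hn
    simp only [List.cons_append, List.mem_cons, List.mem_append, not_or] at ht
    simp only [ladder, run_cx hxd]
    rw [Function.update_of_ne (Ne.symm ht.1), Function.update_of_ne (Ne.symm ht.2.1),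
      Function.update_comm ht.1]
  | x :: xs, d' :: ds, d, hn, t, ht, s, v => by
    have hn' : (d' :: (xs ++ ds)).Nodup := by
      rw [← List.nodup_middle (l₁ := xs)]
      exact ((List.nodup_cons.mp (List.nodup_cons.mp hn).2)).2
    simp only [List.cons_append, List.nodup_cons, List.mem_cons, List.mem_append, not_or] at hn ht
    obtain ⟨⟨hdx, hdxs, hdd', hdds⟩, ⟨hxxs, hxd', hxds⟩, hn2⟩ := hn
    obtain ⟨htd, htx, htxs, htd', htds⟩ := ht
    have ih := fun s v => run_ladder_update hn' (t := t) (by simp [htd', htxs, htds]) s v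
    simp only [ladder, run_append, run_ccx hxd' (Ne.symm hdx) (Ne.symm hdd')]
    rw [Function.update_of_ne (Ne.symm htd), Function.update_of_ne (Ne.symm htx),
      Function.update_of_ne (Ne.symm htd'), Function.update_comm htd, ih,
      Function.update_of_ne (Ne.symm htd), Function.update_of_ne (Ne.symm htx),
      Function.update_of_ne (Ne.symm htd'), Function.update_comm htd]

theorem run_borrowedNot {xs ds : List (Fin N)} {t : Fin N} (hn : (t :: (xs ++ ds)).Nodup)
    (hl : xs.length ≤ ds.length + 1) (s : Fin N → Fin 2) :
    run (borrowedNot xs ds t) s = Function.update s t (s t + conj xs s) := by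
  match xs, ds, hn, hl with
  | [], ds, hn, hl => rfl
  | [x], [], hn, hl =>
    have hxt : x ≠ t := by rintro rfl; simp at hn
    simp [borrowedNot, run_cx hxt, conj]
  | x :: y :: xs, [], hn, hl => simp at hl
  | x :: xs, d :: ds, hn, hl =>
    have hn' : (d :: (xs ++ ds)).Nodup := by
      rw [← List.nodup_middle (l₁ := xs)]
      exact ((List.nodup_cons.mp (List.nodup_cons.mp hn).2)).2
    simp only [List.cons_append, List.nodup_cons, List.mem_cons, List.mem_append, not_or] at hn
    obtain ⟨⟨htx, htxs, htd, htds⟩, ⟨hxxs, hxd, hxds⟩, hn2⟩ := hn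
    have htn : t ∉ d :: (xs ++ ds) := by simp [htd, htxs, htds]
    simp only [borrowedNot, run_append, run_ccx hxd (Ne.symm htx) (Ne.symm htd)]
    obtain ⟨h1, h2⟩ := run_ladder hn' (by simpa using hl) s
    -- The ladder is a palindrome of involutions, hence its own inverse: the borrowed wires are
    -- restored, and `t` has received `x * (d + conj xs)` and `x * d`.
    rw [run_ladder_update hn' htn]
    have inv := run_reverse_run (ladder xs ds d) s
    rw [reverse_ladder] at inv
    rw [inv, Function.update_self, Function.update_idem,
      Function.update_of_ne (Ne.symm htx), Function.update_of_ne (Ne.symm htd), h1,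
      h2 t (by simp [htd, htds]), h2 x (by simp [hxd, hxds]), conj]
    congr 1
    generalize s t = a
    generalize s x = b
    generalize s d = c
    generalize conj xs s = e
    revert a b c e; decide

theorem isClassical_ladder : ∀ (xs ds : List (Fin N)) (d : Fin N), IsClassical (ladder xs ds d)
  | [], _, d => isClassical_x d
  | x :: _, [], d => isClassical_cx x d
  | _ :: xs, d' :: ds, _ =>
    isClassical_append (isClassical_append (isClassical_ccx _ _ _) (isClassical_ladder xs ds d'))
      (isClassical_ccx _ _ _)

theorem isClassical_borrowedNot (xs ds : List (Fin N)) (t : Fin N) :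
    IsClassical (borrowedNot xs ds t) := by
  match xs, ds with
  | [], _ => exact isClassical_x t
  | x :: _, [] => exact isClassical_cx x t
  | _ :: xs, d :: ds =>
    exact isClassical_append (isClassical_append (isClassical_append (isClassical_ccx _ _ _)
      (isClassical_ladder xs ds d)) (isClassical_ccx _ _ _)) (isClassical_ladder xs ds d)

theorem length_ladder_le : ∀ (xs ds : List (Fin N)) (d : Fin N),
    (ladder xs ds d).length ≤ 2 * xs.length + 1
  | [], _, d => by simp [ladder]
  | x :: _, [], d => by
    have := length_cx_le x d
    simp only [ladder, List.length_cons]; omega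
  | x :: xs, d' :: ds, d => by
    have := length_ccx_le x d' d
    have := length_ladder_le xs ds d'
    simp only [ladder, List.length_append, List.length_cons]; omega

theorem length_borrowedNot_le (xs ds : List (Fin N)) (t : Fin N) :
    (borrowedNot xs ds t).length ≤ 4 * xs.length + 1 := by
  match xs, ds with
  | [], _ => simp [borrowedNot]
  | x :: _, [] =>
    have := length_cx_le x t
    simp only [borrowedNot, List.length_cons]; omega
  | x :: xs, d :: ds =>
    have := length_ccx_le x d t
    have := length_ladder_le xs ds d
    simp only [borrowedNot, List.length_append, List.length_cons]; omega

/-! ### Addition -/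

/-- Adds the register `gs` and the carry bit `c` to the register `xs`. -/
def adder : Fin N → List (Fin N) → List (Fin N) → Circuit N
  | _, [], _ => []
  | c, x :: _, [] => cx c x
  | c, x :: xs, g :: gs =>
    (cx c x ++ cx g c ++ ccx x c g) ++ adder g xs gs ++ (ccx x c g ++ cx g c ++ cx g x)

/-- The full adder identity: `g + (x + g) * (c + g)` is the majority of the three bits, hence the
carry. -/
theorem fin_two_carry : ∀ x g c : Fin 2, (x + g + c).val + 2 * (g + (x + g) * (c + g)).val =
    c.val + x.val + g.val := by decide

/-- Ripple-carry addition without extra wires: the carry is written over `g`, serves as incoming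
carry for the higher bits, and is uncomputed afterwards. With `xs` one bit longer than `gs`, the top
bit receives only the carry. -/
theorem run_adder : ∀ {c : Fin N} {xs gs : List (Fin N)}, (c :: (xs ++ gs)).Nodup →
    xs.length ≤ gs.length + 1 → ∀ s : Fin N → Fin 2,
    (∀ w, w ∉ xs → run (adder c xs gs) s w = s w) ∧
      val xs (run (adder c xs gs) s) ≡ (s c).val + val xs s + val gs s [MOD 2 ^ xs.length]
  | c, [], gs, _, _, s => by simp [adder, run_nil, Nat.modEq_one]
  | c, [x], [], hn, _, s => by
    have hcx : c ≠ x := by rintro rfl; simp at hn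
    simp only [adder, run_cx hcx]
    refine ⟨fun w hw => by rw [Function.update_of_ne (by simpa using hw)], ?_⟩
    simp only [val, Function.update_self, List.length_singleton]
    generalize s x = a
    generalize s c = b
    revert a b; decide
  | c, x :: y :: xs, [], _, hl, s => by simp at hl
  | c, x :: xs, g :: gs, hn, hl, s => by
    have hn' : (g :: (xs ++ gs)).Nodup := by
      rw [← List.nodup_middle (l₁ := xs)]
      exact ((List.nodup_cons.mp (List.nodup_cons.mp hn).2)).2
    have hgxs : g ∉ xs := fun h => (List.nodup_cons.mp hn').1 (by simp [h])
    have hggs : g ∉ gs := fun h => (List.nodup_cons.mp hn').1 (by simp [h])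
    simp only [List.cons_append, List.nodup_cons, List.mem_cons, List.mem_append, not_or] at hn
    obtain ⟨⟨hcx, hcxs, hcg, hcgs⟩, ⟨hxxs, hxg, hxgs⟩, -⟩ := hn
    simp only [adder, run_append, run_cx hcx, run_cx (Ne.symm hxg), run_cx (Ne.symm hcg),
      run_ccx (Ne.symm hcx) hxg hcg]
    set s1 := Function.update s x (s x + s g) with hs1
    set s2 := Function.update s1 c (s1 c + s1 g) with hs2
    set s3 := Function.update s2 g (s2 g + s2 x * s2 c) with hs3
    obtain ⟨ih1, ih2⟩ := run_adder hn' (by simpa using hl) s3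
    set s4 := run (adder g xs gs) s3 with hs4
    have e1x : s1 x = s x + s g := Function.update_self ..
    have e1c : s1 c = s c := Function.update_of_ne hcx ..
    have e1g : s1 g = s g := Function.update_of_ne (Ne.symm hxg) ..
    have e2x : s2 x = s x + s g := by rw [hs2, Function.update_of_ne (Ne.symm hcx), e1x]
    have e2c : s2 c = s c + s g := by rw [hs2, Function.update_self, e1c, e1g]
    have e2g : s2 g = s g := by rw [hs2, Function.update_of_ne (Ne.symm hcg), e1g]
    have e3x : s3 x = s x + s g := by rw [hs3, Function.update_of_ne hxg, e2x]
    have e3c : s3 c = s c + s g := by rw [hs3, Function.update_of_ne hcg, e2c]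
    have e3g : s3 g = s g + (s x + s g) * (s c + s g) := by
      rw [hs3, Function.update_self, e2g, e2x, e2c]
    have e3 : ∀ w, w ≠ x → w ≠ c → w ≠ g → s3 w = s w := fun w h1 h2 h3 => by
      rw [hs3, Function.update_of_ne h3, hs2, Function.update_of_ne h2, hs1,
        Function.update_of_ne h1]
    have e4x := (ih1 x hxxs).trans e3x
    have e4c := (ih1 c hcxs).trans e3c
    have e4g := (ih1 g hgxs).trans e3g
    set s5 := Function.update s4 g (s4 g + s4 x * s4 c) with hs5
    set s6 := Function.update s5 c (s5 c + s5 g) with hs6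
    have e5x : s5 x = s x + s g := by rw [hs5, Function.update_of_ne hxg, e4x]
    have e5c : s5 c = s c + s g := by rw [hs5, Function.update_of_ne hcg, e4c]
    have e5g : s5 g = s g := by
      rw [hs5, Function.update_self, e4g, e4x, e4c, fin_two_add_add]
    have e6x : s6 x = s x + s g := by rw [hs6, Function.update_of_ne (Ne.symm hcx), e5x]
    have e6c : s6 c = s c := by rw [hs6, Function.update_self, e5c, e5g, fin_two_add_add]
    have e6g : s6 g = s g := by rw [hs6, Function.update_of_ne (Ne.symm hcg), e5g]
    have e6 : ∀ w, w ≠ c → w ≠ g → s6 w = s4 w := fun w h1 h2 => by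
      rw [hs6, Function.update_of_ne h1, hs5, Function.update_of_ne h2]
    rw [e6x, e6c]
    refine ⟨fun w hw => ?_, ?_⟩
    · simp only [List.mem_cons, not_or] at hw
      rw [Function.update_of_ne hw.1]
      by_cases h1 : w = c
      · rw [h1, e6c]
      by_cases h2 : w = g
      · rw [h2, e6g]
      rw [e6 w h1 h2, ih1 w hw.2, e3 w hw.1 h1 h2]
    · have v1 : val xs (Function.update s6 x (s x + s g + s c)) = val xs s4 :=
        val_congr fun w hw => by
          rw [Function.update_of_ne (by rintro rfl; exact hxxs hw),
            e6 w (by rintro rfl; exact hcxs hw) (by rintro rfl; exact hgxs hw)]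
      have v2 : val xs s3 = val xs s := val_congr fun w hw =>
        e3 w (by rintro rfl; exact hxxs hw) (by rintro rfl; exact hcxs hw)
          (by rintro rfl; exact hgxs hw)
      have v3 : val gs s3 = val gs s := val_congr fun w hw =>
        e3 w (by rintro rfl; exact hxgs hw) (by rintro rfl; exact hcgs hw)
          (by rintro rfl; exact hggs hw)
      rw [val, val, val, Function.update_self, v1, List.length_cons, pow_succ, mul_comm _ 2]
      rw [v2, v3, e3g] at ih2
      have := (ih2.mul_left' 2).add_left (s x + s g + s c).val
      have hc := fin_two_carry (s x) (s g) (s c)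
      convert this using 1
      omega

theorem isClassical_adder : ∀ (c : Fin N) (xs gs : List (Fin N)), IsClassical (adder c xs gs)
  | _, [], _ => by simp [adder, IsClassical]
  | c, x :: _, [] => isClassical_cx c x
  | c, x :: xs, g :: gs =>
    isClassical_append (isClassical_append (isClassical_append (isClassical_append
      (isClassical_cx _ _) (isClassical_cx _ _)) (isClassical_ccx _ _ _))
      (isClassical_adder g xs gs)) (isClassical_append (isClassical_append
      (isClassical_ccx _ _ _) (isClassical_cx _ _)) (isClassical_cx _ _))

theorem length_adder_le : ∀ (c : Fin N) (xs gs : List (Fin N)),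
    (adder c xs gs).length ≤ 6 * xs.length
  | _, [], _ => by simp [adder]
  | c, x :: _, [] => by
    have := length_cx_le c x
    simp only [adder, List.length_cons]; omega
  | c, x :: xs, g :: gs => by
    have := length_cx_le c x
    have := length_cx_le g x
    have := length_cx_le g c
    have := length_ccx_le x c g
    have := length_adder_le g xs gs
    simp only [adder, List.length_append, List.length_cons]; omega

/-- Adds the bit `b` to every wire of `xs`. -/
def fanout (b : Fin N) (xs : List (Fin N)) : Circuit N := xs.flatMap (cx b)

theorem run_fanout {b : Fin N} : ∀ {xs : List (Fin N)}, (b :: xs).Nodup → ∀ s : Fin N → Fin 2,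
    (∀ w, w ∉ xs → run (fanout b xs) s w = s w) ∧ ∀ w ∈ xs, run (fanout b xs) s w = s w + s b
  | [], _, s => by simp [fanout, run_nil]
  | x :: xs, hn, s => by
    simp only [List.nodup_cons, List.mem_cons, not_or] at hn
    obtain ⟨⟨hbx, hbxs⟩, hxxs, hn⟩ := hn
    obtain ⟨h1, h2⟩ := run_fanout (b := b) (xs := xs) (by simp [hbxs, hn]) s
    have hf : fanout b (x :: xs) = cx b x ++ fanout b xs := rfl
    rw [hf, run_append, run_cx hbx, h1 x hxxs, h1 b hbxs]
    refine ⟨fun w hw => ?_, fun w hw => ?_⟩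
    · simp only [List.mem_cons, not_or] at hw
      rw [Function.update_of_ne hw.1, h1 w hw.2]
    · by_cases h : w = x
      · rw [h, Function.update_self]
      · rw [Function.update_of_ne h]
        exact h2 w ((List.mem_cons.mp hw).resolve_left h)

theorem isClassical_fanout (b : Fin N) (xs : List (Fin N)) : IsClassical (fanout b xs) := by
  intro g hg
  obtain ⟨x, -, hx⟩ := List.mem_flatMap.mp hg
  exact isClassical_cx b x g hx

theorem length_fanout_le (b : Fin N) : ∀ xs : List (Fin N), (fanout b xs).length ≤ xs.length
  | [] => by simp [fanout]
  | x :: xs => by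
    have hf : fanout b (x :: xs) = cx b x ++ fanout b xs := rfl
    have := length_cx_le b x
    have := length_fanout_le b xs
    rw [hf, List.length_append, List.length_cons]; omega

theorem val_complement {s s' : Fin N → Fin 2} : ∀ {xs : List (Fin N)},
    (∀ w ∈ xs, s' w = s w + 1) → val xs s' + val xs s + 1 = 2 ^ xs.length
  | [], _ => by simp [val]
  | x :: xs, h => by
    have ih := val_complement (s := s) (s' := s') (xs := xs) fun w hw => h w (by simp [hw])
    have h1 : (s' x).val + (s x).val = 1 := by
      rw [h x (by simp)]
      generalize s x = a
      revert a; decide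
    rw [val, val, List.length_cons, pow_succ]; omega

/-- If the circuit `T` adds a bit `A` to the wire `b`, then this circuit adds the number `A` to the
register `xs` and borrows the wires `b` and `gs`. -/
def controlledIncrement (xs gs : List (Fin N)) (b : Fin N) (T : Circuit N) : Circuit N :=
  fanout b xs ++ T ++ adder b xs gs ++ T ++ (adder b xs gs).reverse ++ fanout b xs

/-- Subtracting `gs + b` and adding `gs + (b + A)`, the inner sum modulo two, leaves `A` if `b = 0`
but `-A` if `b = 1`. Conditional complementation, `v ↦ -1 - v`, before and after turns the second
case into `+A` too. -/
theorem run_controlledIncrement {xs gs : List (Fin N)} {b : Fin N} {T : Circuit N}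
    (hn : (b :: (xs ++ gs)).Nodup) (hl : xs.length ≤ gs.length + 1)
    {A : (Fin N → Fin 2) → Fin 2} (hT : ∀ s, run T s = Function.update s b (s b + A s))
    (hA : ∀ s s' : Fin N → Fin 2, (∀ w, w ∉ xs → w ≠ b → s w = s' w) → A s = A s')
    (s : Fin N → Fin 2) :
    (∀ w, w ∉ xs → run (controlledIncrement xs gs b T) s w = s w) ∧
      val xs (run (controlledIncrement xs gs b T) s) ≡ val xs s + (A s).val
        [MOD 2 ^ xs.length] := by
  have hbxs : b ∉ xs := fun h => (List.nodup_cons.mp hn).1 (by simp [h])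
  have hbgs : b ∉ gs := fun h => (List.nodup_cons.mp hn).1 (by simp [h])
  have hxg : ∀ w ∈ gs, w ∉ xs := fun w hw hw' =>
    (List.nodup_append.mp (List.nodup_cons.mp hn).2).2.2 w hw' w hw rfl
  have hnf : (b :: xs).Nodup :=
    List.nodup_cons.mpr ⟨hbxs, (List.nodup_append.mp (List.nodup_cons.mp hn).2).1⟩
  have hfan : ∀ u : Fin N → Fin 2, (∀ w, w ∉ xs → run (fanout b xs) u w = u w) ∧
      (u b = 0 → val xs (run (fanout b xs) u) = val xs u) ∧
      (u b = 1 → val xs (run (fanout b xs) u) + val xs u + 1 = 2 ^ xs.length) := by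
    intro u
    obtain ⟨f1, f2⟩ := run_fanout hnf u
    refine ⟨f1, fun hu => val_congr fun w hw => by rw [f2 w hw, hu, add_zero],
      fun hu => val_complement fun w hw => by rw [f2 w hw, hu]⟩
  simp only [controlledIncrement, run_append]
  obtain ⟨k1, f1, f1'⟩ := hfan s
  set s1 := run (fanout b xs) s
  -- The subtraction is described by applying the adder lemma to its output, from which the adder
  -- recovers `s1`.
  obtain ⟨k2, a2⟩ := run_adder hn hl (run (adder b xs gs).reverse s1)
  rw [run_run_reverse] at k2 a2
  set s2 := run (adder b xs gs).reverse s1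
  have g2 : val gs s1 = val gs s2 := val_congr fun w hw => k2 w (hxg w hw)
  have hs3 := hT s2
  set s3 := run T s2
  -- The bit `A` ignores `xs` and `b`, so both runs of `T` add the same bit and the second restores
  -- `b`.
  have A2 : A s2 = A s := hA _ _ fun w hw _ => by rw [← k2 w hw, k1 w hw]
  have k3 : ∀ w, w ≠ b → s3 w = s2 w := fun w hw => by rw [hs3, Function.update_of_ne hw]
  have b3 : s3 b = s b + A s := by
    rw [hs3, Function.update_self, A2, ← k2 b hbxs, k1 b hbxs]
  obtain ⟨k4, a4⟩ := run_adder hn hl s3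
  set s4 := run (adder b xs gs) s3
  have hs5 := hT s4
  set s5 := run T s4
  have A4 : A s4 = A s := hA _ _ fun w hw hwb => by
    rw [k4 w hw, k3 w hwb, ← k2 w hw, k1 w hw]
  have k5 : ∀ w, w ≠ b → s5 w = s4 w := fun w hw => by rw [hs5, Function.update_of_ne hw]
  have b5 : s5 b = s b := by
    rw [hs5, Function.update_self, A4, k4 b hbxs, b3, fin_two_add_add]
  obtain ⟨k6, f6, f6'⟩ := hfan s5
  set s6 := run (fanout b xs) s5
  refine ⟨fun w hw => ?_, ?_⟩
  · rw [k6 w hw]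
    by_cases hb : w = b
    · rw [hb, b5]
    · rw [k5 w hb, k4 w hw, k3 w hb, ← k2 w hw, k1 w hw]
  · have v3 : val xs s3 = val xs s2 := val_congr fun w hw =>
      k3 w (by rintro rfl; exact hbxs hw)
    have g3 : val gs s3 = val gs s2 := val_congr fun w hw =>
      k3 w (by rintro rfl; exact hbgs hw)
    have v5 : val xs s5 = val xs s4 := val_congr fun w hw =>
      k5 w (by rintro rfl; exact hbxs hw)
    rw [b3, v3, g3] at a4
    rw [← k2 b hbxs, k1 b hbxs] at a2
    rw [b5, v5] at f6 f6'
    rw [← ZMod.natCast_eq_natCast_iff] at a2 a4 ⊢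
    have hM : ((2 ^ xs.length : ℕ) : ZMod (2 ^ xs.length)) = 0 := ZMod.natCast_self _
    have cast0 := fun h => congrArg (Nat.cast : ℕ → ZMod (2 ^ xs.length)) (f1 h)
    have cast1 := fun h => congrArg (Nat.cast : ℕ → ZMod (2 ^ xs.length)) (f1' h)
    have cast6 := fun h => congrArg (Nat.cast : ℕ → ZMod (2 ^ xs.length)) (f6 h)
    have cast6' := fun h => congrArg (Nat.cast : ℕ → ZMod (2 ^ xs.length)) (f6' h)
    rw [hM] at cast1 cast6'
    have two : ∀ a : Fin 2, a = 0 ∨ a = 1 := by decide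
    push_cast at a2 a4 cast0 cast1 cast6 cast6' ⊢
    rcases two (s b) with hb | hb <;> rcases two (A s) with ha | ha <;>
      simp only [hb, ha, forall_const, add_zero, zero_add, Fin.val_zero, Fin.val_one,
        Nat.cast_zero, Nat.cast_one, show (1 : Fin 2) + 1 = 0 from rfl,
        zero_ne_one, one_ne_zero, IsEmpty.forall_iff] at a2 a4 cast0 cast1 cast6 cast6' ⊢
    · linear_combination cast6 + a4 - a2 + cast0
    · linear_combination cast6 + a4 - a2 + cast0
    · linear_combination cast6' - a4 + a2 - cast1
    · linear_combination cast6' - a4 + a2 - cast1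

theorem isClassical_controlledIncrement (xs gs : List (Fin N)) (b : Fin N) {T : Circuit N}
    (hT : IsClassical T) : IsClassical (controlledIncrement xs gs b T) :=
  isClassical_append (isClassical_append (isClassical_append (isClassical_append
    (isClassical_append (isClassical_fanout b xs) hT) (isClassical_adder b xs gs)) hT)
    (isClassical_reverse (isClassical_adder b xs gs))) (isClassical_fanout b xs)

theorem length_controlledIncrement_le (xs gs : List (Fin N)) (b : Fin N) (T : Circuit N) :
    (controlledIncrement xs gs b T).length ≤ 14 * xs.length + 2 * T.length := by
  have := length_fanout_le b xs
  have := length_adder_le b xs gs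
  simp only [controlledIncrement, List.length_append, List.length_reverse]; omega

/-- Increments the register `ws` and borrows the wire `b`: the upper half is incremented if all
bits of the lower half are set, then the lower half is incremented. -/
def incrementer (ws : List (Fin N)) (b : Fin N) : Circuit N :=
  let low := ws.take ((ws.length + 1) / 2)
  let high := ws.drop ((ws.length + 1) / 2)
  controlledIncrement low high b [.x b] ++
    controlledIncrement high low b (borrowedNot low high b)

/-- The upper half goes first, while the lower half still shows whether it will overflow. Rounding
the lower length up keeps the two lengths within one of each other, so each half is long enough to
be borrowed by the other. -/
theorem run_incrementer {ws : List (Fin N)} {b : Fin N} (hn : (b :: ws).Nodup)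
    (s : Fin N → Fin 2) :
    (∀ w, w ∉ ws → run (incrementer ws b) s w = s w) ∧
      val ws (run (incrementer ws b) s) ≡ val ws s + 1 [MOD 2 ^ ws.length] := by
  set low := ws.take ((ws.length + 1) / 2) with hlow
  set high := ws.drop ((ws.length + 1) / 2) with hhigh
  have hws : ws = low ++ high := (List.take_append_drop _ _).symm
  have ll : low.length = (ws.length + 1) / 2 := by
    rw [hlow, List.length_take]; omega
  have lh : high.length = ws.length - (ws.length + 1) / 2 := by rw [hhigh, List.length_drop]
  have hinc : incrementer ws b = controlledIncrement low high b [.x b] ++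
    controlledIncrement high low b (borrowedNot low high b) := rfl
  clear_value low high
  rw [hinc]
  have hn1 : (b :: (low ++ high)).Nodup := by rwa [← hws]
  have hn2 : (b :: (high ++ low)).Nodup :=
    ((List.perm_append_comm (l₁ := high) (l₂ := low)).cons b).nodup_iff.mpr hn1
  have hbl : b ∉ low := fun h => (List.nodup_cons.mp hn1).1 (by simp [h])
  have hlh : ∀ w ∈ low, w ∉ high := fun w hw hw' =>
    (List.nodup_append.mp (List.nodup_cons.mp hn1).2).2.2 w hw w hw' rfl
  rw [run_append]
  obtain ⟨k1, v1⟩ := run_controlledIncrement hn2 (by omega)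
    (run_borrowedNot hn1 (by omega))
    (fun s s' h => conj_congr fun w hw => h w (hlh w hw) (by rintro rfl; exact hbl hw)) s
  set s1 := run (controlledIncrement high low b (borrowedNot low high b)) s
  obtain ⟨k2, v2⟩ := run_controlledIncrement (T := [.x b]) (A := fun _ => 1) hn1 (by omega)
    (fun s => rfl) (fun _ _ _ => rfl) s1
  set s2 := run (controlledIncrement low high b [.x b]) s1
  refine ⟨fun w hw => ?_, ?_⟩
  · rw [hws, List.mem_append, not_or] at hw
    rw [k2 w hw.1, k1 w hw.2]
  · have el : val low s1 = val low s := val_congr fun w hw => k1 w (hlh w hw)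
    have eh : val high s2 = val high s1 := val_congr fun w hw => k2 w fun h => hlh w h hw
    rw [hws, val_append, val_append, eh, List.length_append, pow_add]
    rw [el] at v2
    have b0 := val_lt s low
    have b2 := val_lt s2 low
    have hc := conj_eq_one_iff s low
    have hcong := (v1.mul_left' (2 ^ low.length)).add_left (val low s2)
    refine hcong.trans ?_
    by_cases h : val low s + 1 = 2 ^ low.length
    · rw [hc.mpr h]
      simp only [Fin.val_one] at v2 ⊢
      rw [h] at v2
      have h2 : val low s2 = 0 := by
        have v3 : val low s2 ≡ 0 [MOD 2 ^ low.length] :=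
          v2.trans (by simp [Nat.ModEq])
        exact v3.eq_of_lt_of_lt b2 (by positivity)
      rw [h2, mul_add, mul_one, ← h]
      exact congrArg (· % _) (by ring)
    · have hz : conj low s = 0 := by
        have two : ∀ a : Fin 2, a ≠ 1 → a = 0 := by decide
        exact two _ fun h' => h (hc.mp h')
      rw [hz]
      have h2 : val low s2 = val low s + 1 :=
        Nat.ModEq.eq_of_lt_of_lt v2 b2 (by omega)
      rw [h2]
      exact congrArg (· % _) (by simp; ring)

theorem isClassical_incrementer (ws : List (Fin N)) (b : Fin N) :
    IsClassical (incrementer ws b) :=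
  isClassical_append (isClassical_controlledIncrement _ _ _ (isClassical_x b))
    (isClassical_controlledIncrement _ _ _ (isClassical_borrowedNot _ _ _))

/-- The controlled increments cost 14 gates per wire; computing the carry twice costs at most 8 more
per wire of the lower half. -/
theorem length_incrementer_le (ws : List (Fin N)) (b : Fin N) :
    (incrementer ws b).length ≤ 22 * ws.length + 4 := by
  set low := ws.take ((ws.length + 1) / 2) with hlow
  set high := ws.drop ((ws.length + 1) / 2) with hhigh
  have hinc : incrementer ws b = controlledIncrement low high b [.x b] ++
    controlledIncrement high low b (borrowedNot low high b) := rfl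
  have h1 := length_controlledIncrement_le low high b [.x b]
  have h2 := length_controlledIncrement_le high low b (borrowedNot low high b)
  have h3 := length_borrowedNot_le low high b
  have h4 : low.length + high.length = ws.length := by
    rw [← List.length_append, List.take_append_drop]
  rw [hinc, List.length_append]
  simp only [List.length_singleton] at h1
  omega

/-! ### Multiply controlled gates with one borrowed wire -/

/-- Adds the conjunction of the wires `cs` to the wire `t` and borrows the wire `b`. -/
def multiNot (cs : List (Fin N)) (t b : Fin N) : Circuit N :=
  (incrementer cs b).reverse ++ incrementer (cs ++ [t]) b

/-- With `t` as the top bit, incrementing flips `t` exactly when all controls are set; decrementing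
the controls alone restores them and keeps that flip. -/
theorem run_multiNot {cs : List (Fin N)} {t b : Fin N} (hn : (b :: (cs ++ [t])).Nodup)
    (s : Fin N → Fin 2) :
    run (multiNot cs t b) s = Function.update s t (s t + conj cs s) := by
  have htc : t ∉ cs := fun h =>
    (List.nodup_append.mp (List.nodup_cons.mp hn).2).2.2 t h t (by simp) rfl
  have hnc : (b :: cs).Nodup := by
    have : (b :: (cs ++ [t])) = (b :: cs) ++ [t] := rfl
    rw [this] at hn
    exact (List.nodup_append.mp hn).1
  rw [multiNot, run_append]
  obtain ⟨k1, v1⟩ := run_incrementer hn s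
  set s1 := run (incrementer (cs ++ [t]) b) s
  obtain ⟨k2, v2⟩ := run_incrementer hnc (run (incrementer cs b).reverse s1)
  rw [run_run_reverse] at k2 v2
  set s2 := run (incrementer cs b).reverse s1
  simp only [val_append, val, List.length_append, List.length_singleton, pow_succ, mul_zero,
    add_zero] at v1
  have hM : 0 < 2 ^ cs.length := by positivity
  have l0 := val_lt s cs
  have l1 := val_lt s1 cs
  have l2 := val_lt s2 cs
  have hc := conj_eq_one_iff s cs
  generalize 2 ^ cs.length = M at *
  -- Reducing modulo `M` forgets the top bit and leaves a plain increment of the controls.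
  have v1' : val cs s1 ≡ val cs s + 1 [MOD M] := by
    have := Nat.ModEq.of_mul_right 2 v1
    simpa [Nat.ModEq, add_right_comm, Nat.add_mod] using this
  have e : val cs s2 = val cs s :=
    (Nat.ModEq.add_right_cancel' 1 (v2.symm.trans v1')).eq_of_lt_of_lt l2 l0
  have et : s1 t = s t + conj cs s := by
    have two : ∀ a : Fin 2, a = 0 ∨ a = 1 := by decide
    have hlt : val cs s1 + M * (s1 t).val < M * 2 := by
      have : (s1 t).val ≤ 1 := Nat.le_of_lt_succ (s1 t).isLt
      nlinarith
    have v3 := v1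
    rw [Nat.ModEq, Nat.mod_eq_of_lt hlt] at v3
    by_cases h : val cs s + 1 = M
    · rw [hc.mpr h]
      rcases two (s t) with h0 | h0 <;> rcases two (s1 t) with h1 | h1 <;>
        simp only [h0, h1, Fin.val_zero, Fin.val_one, mul_zero, mul_one, add_zero] at v3 ⊢
      · rw [h, Nat.mod_eq_of_lt (by omega)] at v3; omega
      · rfl
      · rfl
      · rw [show val cs s + M + 1 = M * 2 by omega, Nat.mod_self] at v3; omega
    · have hz : conj cs s = 0 := by
        have two : ∀ a : Fin 2, a ≠ 1 → a = 0 := by decide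
        exact two _ fun h' => h (hc.mp h')
      rw [hz, add_zero]
      rcases two (s t) with h0 | h0 <;> rcases two (s1 t) with h1 | h1 <;>
        simp only [h0, h1, Fin.val_zero, Fin.val_one, mul_zero, mul_one, add_zero] at v3 ⊢
      · rw [Nat.mod_eq_of_lt (by omega)] at v3; omega
      · rw [Nat.mod_eq_of_lt (by omega)] at v3; omega
  funext w
  by_cases hwt : w = t
  · rw [hwt, Function.update_self, ← k2 t htc, et]
  · rw [Function.update_of_ne hwt]
    by_cases hw : w ∈ cs
    · exact eq_of_val_eq e w hw
    · rw [← k2 w hw, k1 w (by simp [hw, hwt])]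

theorem isClassical_multiNot (cs : List (Fin N)) (t b : Fin N) : IsClassical (multiNot cs t b) :=
  isClassical_append (isClassical_reverse (isClassical_incrementer _ _))
    (isClassical_incrementer _ _)

theorem length_multiNot_le (cs : List (Fin N)) (t b : Fin N) :
    (multiNot cs t b).length ≤ 44 * cs.length + 30 := by
  have h1 := length_incrementer_le cs b
  have h2 := length_incrementer_le (cs ++ [t]) b
  simp only [multiNot, List.length_append, List.length_reverse, List.length_singleton] at *
  omega

end Classical

/-! ### Matrices of circuits -/

section CircuitMatrices

variable {N : ℕ}

/-- Only the two basis states that agree with `y` off the wire `q` contribute. -/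
theorem mul_onWire_apply (M : Matrix (Fin N → Fin 2) (Fin N → Fin 2) ℂ) (q : Fin N)
    (U : Matrix (Fin 2) (Fin 2) ℂ) (x y : Fin N → Fin 2) :
    (M * onWire q U) x y = ∑ b, M x (Function.update y q b) * U b (y q) := by
  rw [Matrix.mul_apply]
  symm
  refine Fintype.sum_of_injective (fun b => Function.update y q b)
    (Function.update_injective y q) _ _ (fun z hz => ?_) fun b => ?_
  · rw [onWire, of_apply, if_neg, mul_zero]
    intro h
    refine hz ⟨z q, ?_⟩
    funext r
    by_cases hr : r = q
    · simp only [hr, Function.update_self]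
    · simp only [Function.update_of_ne hr]; exact (h r hr).symm
  · rw [onWire, of_apply, if_pos fun r hr => Function.update_of_ne hr _ _, Function.update_self]

theorem onWire_mul (q : Fin N) (U V : Matrix (Fin 2) (Fin 2) ℂ) :
    onWire q U * onWire q V = onWire q (U * V) := by
  ext x y
  rw [mul_onWire_apply]
  simp only [onWire, of_apply, Function.update_self]
  have (b : Fin 2) : (∀ r, r ≠ q → x r = Function.update y q b r) ↔ ∀ r, r ≠ q → x r = y r :=
    forall₂_congr fun r hr => by rw [Function.update_of_ne hr]
  simp only [this]
  split_ifs <;> simp [Matrix.mul_apply]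

theorem onWire_diagonal (q : Fin N) (d : Fin 2 → ℂ) :
    onWire q (diagonal d) = diagonal fun x => d (x q) := by
  ext x y
  by_cases h : x = y
  · subst h; simp [onWire]
  · rw [diagonal_apply_ne _ h, onWire, of_apply]
    split_ifs with h1
    · refine diagonal_apply_ne _ fun hq => h (funext fun r => ?_)
      by_cases hr : r = q
      · rw [hr, hq]
      · exact h1 r hr
    · rfl

theorem onWire_one (q : Fin N) : onWire q 1 = 1 := by
  rw [← diagonal_one, onWire_diagonal, diagonal_one]

theorem onWire_conjTranspose (q : Fin N) (U : Matrix (Fin 2) (Fin 2) ℂ) :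
    (onWire q U)ᴴ = onWire q Uᴴ := by
  ext x y
  simp only [onWire, conjTranspose_apply, of_apply, eq_comm (a := x _), apply_ite star, star_zero]

theorem basisMap_mul (f g : (Fin N → Fin 2) → Fin N → Fin 2) :
    basisMap f * basisMap g = basisMap (f ∘ g) := by
  ext x y
  simp [basisMap, Matrix.mul_apply]

theorem basisMap_id : basisMap (id : (Fin N → Fin 2) → Fin N → Fin 2) = 1 := by
  ext x y
  simp [basisMap, Matrix.one_apply]

theorem diagonal_mul_basisMap (d : (Fin N → Fin 2) → ℂ) (f : (Fin N → Fin 2) → Fin N → Fin 2) :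
    diagonal d * basisMap f = basisMap f * diagonal (d ∘ f) := by
  ext x y
  rw [diagonal_mul, mul_diagonal, basisMap, of_apply]
  split_ifs with h
  · simp [h]
  · simp

theorem basisMap_conjTranspose {f : (Fin N → Fin 2) → Fin N → Fin 2}
    (hf : Function.Involutive f) : (basisMap f)ᴴ = basisMap f := by
  ext x y
  have : y = f x ↔ x = f y := by
    constructor <;> rintro rfl <;> rw [hf]
  simp [basisMap, this, apply_ite]

theorem onWire_pauliX (q : Fin N) :
    onWire q pauliX = basisMap fun s => Function.update s q (s q + 1) := by
  ext x y
  have : x = Function.update y q (y q + 1) ↔ (∀ r, r ≠ q → x r = y r) ∧ x q = y q + 1 := by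
    rw [Function.eq_update_iff, and_comm]
  simp only [onWire, basisMap, of_apply, pauliX_apply, this, ite_and]

theorem onWire_pauliZ (q : Fin N) :
    onWire q pauliZ = diagonal fun s => ((sign (s q) : ℝ) : ℂ) := by
  rw [pauliZ_eq_diagonal, onWire_diagonal]

theorem inv_sqrt_two_mul_self : (((1 / √2 : ℝ) : ℂ)) * ((1 / √2 : ℝ) : ℂ) = 1 / 2 := by
  rw [← Complex.ofReal_mul, div_mul_div_comm, Real.mul_self_sqrt (by norm_num)]
  norm_num

theorem hadamard_mul_self : hadamard * hadamard = 1 := by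
  rw [hadamard, smul_mul_smul_comm, inv_sqrt_two_mul_self]
  ext a b
  fin_cases a <;> fin_cases b <;> norm_num [Matrix.mul_apply, Fin.sum_univ_two]

theorem hadamard_mul_pauliX_mul_hadamard : hadamard * pauliX * hadamard = pauliZ := by
  rw [hadamard, smul_mul_assoc, smul_mul_smul_comm, inv_sqrt_two_mul_self]
  ext a b
  fin_cases a <;> fin_cases b <;> norm_num [Matrix.mul_apply, Fin.sum_univ_two, pauliX, pauliZ]

theorem hadamard_conjTranspose : hadamardᴴ = hadamard := by
  ext a b
  fin_cases a <;> fin_cases b <;> simp [hadamard]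

theorem pauliZ_mul_self : pauliZ * pauliZ = 1 := by
  ext a b
  fin_cases a <;> fin_cases b <;> simp [pauliZ, Matrix.mul_apply]

theorem pauliZ_conjTranspose : pauliZᴴ = pauliZ := by
  ext a b
  fin_cases a <;> fin_cases b <;> simp [pauliZ]

theorem Gate.mat_eq_basisMap {g : Gate N} (hg : g.isClassical = true) : g.mat = basisMap g.act := by
  cases g with
  | had q => simp [Gate.isClassical] at hg
  | z q => simp [Gate.isClassical] at hg
  | x q => exact onWire_pauliX q
  | cnot c t h => rfl
  | toffoli c d t h1 h2 h3 => rfl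

theorem Gate.mat_mul_self_and_conjTranspose (g : Gate N) : g.mat * g.mat = 1 ∧ g.matᴴ = g.mat := by
  by_cases hg : g.isClassical = true
  · rw [Gate.mat_eq_basisMap hg, basisMap_mul, basisMap_conjTranspose g.act_act]
    refine ⟨?_, rfl⟩
    rw [Function.Involutive.comp_self g.act_act, basisMap_id]
  · cases g with
    | had q => simp [Gate.mat, onWire_mul, onWire_conjTranspose, hadamard_mul_self, onWire_one,
        hadamard_conjTranspose]
    | z q => simp [Gate.mat, onWire_mul, onWire_conjTranspose, pauliZ_mul_self, onWire_one,
        pauliZ_conjTranspose]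
    | x q => simp [Gate.isClassical] at hg
    | cnot c t h => simp [Gate.isClassical] at hg
    | toffoli c d t h1 h2 h3 => simp [Gate.isClassical] at hg

theorem circuitMat_append (G H : Circuit N) :
    circuitMat (G ++ H) = circuitMat G * circuitMat H := by
  simp [circuitMat]

theorem circuitMat_cons (g : Gate N) (G : Circuit N) :
    circuitMat (g :: G) = g.mat * circuitMat G := by
  simp [circuitMat]

theorem circuitMat_nil : circuitMat ([] : Circuit N) = 1 := rfl

theorem circuitMat_singleton (g : Gate N) : circuitMat [g] = g.mat := by
  simp [circuitMat]

theorem circuitMat_reverse (G : Circuit N) : circuitMat G.reverse = (circuitMat G)ᴴ := by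
  induction G with
  | nil => simp [circuitMat]
  | cons g G ih =>
    rw [List.reverse_cons, circuitMat_append, circuitMat_singleton, circuitMat_cons,
      conjTranspose_mul, ih, g.mat_mul_self_and_conjTranspose.2]

theorem circuitMat_mul_conjTranspose (G : Circuit N) : circuitMat G * (circuitMat G)ᴴ = 1 := by
  induction G with
  | nil => simp [circuitMat]
  | cons g G ih =>
    rw [circuitMat_cons, conjTranspose_mul, Matrix.mul_assoc, ← Matrix.mul_assoc (circuitMat G), ih,
      Matrix.one_mul, g.mat_mul_self_and_conjTranspose.2, g.mat_mul_self_and_conjTranspose.1]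

theorem circuitMat_eq_basisMap {G : Circuit N} (hG : IsClassical G) :
    circuitMat G = basisMap (run G) := by
  induction G with
  | nil => exact basisMap_id.symm
  | cons g G ih =>
    rw [circuitMat_cons, Gate.mat_eq_basisMap (hG g (by simp)),
      ih fun g' hg' => hG g' (by simp [hg']), basisMap_mul]
    rfl

/-- Conjugation with Hadamard gates turns a controlled `X` into a controlled `Z`. -/
theorem hadamard_conj_basisMap (t : Fin N) (φ : (Fin N → Fin 2) → Fin 2)
    (hφ : ∀ s b, φ (Function.update s t b) = φ s) :
    onWire t hadamard * basisMap (fun s => Function.update s t (s t + φ s)) * onWire t hadamard =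
      diagonal fun s => if s t = 1 ∧ φ s = 1 then -1 else 1 := by
  set D : Matrix (Fin N → Fin 2) (Fin N → Fin 2) ℂ := diagonal fun s => if φ s = 1 then 1 else 0
    with hD
  have hcomm (U : Matrix (Fin 2) (Fin 2) ℂ) : onWire t U * D = D * onWire t U := by
    ext x y
    rw [hD, mul_diagonal, diagonal_mul, mul_comm]
    simp only [onWire, of_apply]
    by_cases h : ∀ r, r ≠ t → x r = y r
    · have : x = Function.update y t (x t) := by
        rw [Function.eq_update_iff]; exact ⟨rfl, h⟩
      rw [this, hφ]
    · simp [h]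
  -- The projection `D` onto `φ = 1` commutes with everything on wire `t`, so the conjugation
  -- reduces to `H * H = 1` and `H * X * H = Z`.
  have hsplit : basisMap (fun s => Function.update s t (s t + φ s)) =
      (1 - D) + D * onWire t pauliX := by
    ext x y
    rw [← hcomm, hD, Matrix.add_apply, Matrix.sub_apply, mul_diagonal, onWire_pauliX]
    have two : ∀ a : Fin 2, a = 0 ∨ a = 1 := by decide
    rcases two (φ y) with h | h
    · by_cases hxy : x = y
      · subst hxy; simp [basisMap, h]
      · simp [basisMap, h, hxy]
    · by_cases hxy : x = y
      · subst hxy; simp [basisMap, h]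
      · simp [basisMap, h, hxy]
  rw [hsplit, Matrix.mul_add, Matrix.add_mul, Matrix.mul_sub, Matrix.sub_mul, Matrix.mul_one,
    onWire_mul, hadamard_mul_self, onWire_one, hcomm, Matrix.mul_assoc D, onWire_mul,
    hadamard_mul_self, onWire_one, Matrix.mul_one, ← Matrix.mul_assoc (onWire t hadamard), hcomm,
    Matrix.mul_assoc D, onWire_mul, Matrix.mul_assoc D, onWire_mul,
    hadamard_mul_pauliX_mul_hadamard, onWire_pauliZ, hD, diagonal_mul_diagonal, ← diagonal_one,
    diagonal_sub, diagonal_add]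
  congr 1
  funext s
  have two : ∀ a : Fin 2, a = 0 ∨ a = 1 := by decide
  rcases two (φ s) with h | h <;> rcases two (s t) with h' | h' <;> simp [h, h', sign]

end CircuitMatrices

/-! ### Circuits with an ancilla -/

/-- The basis states of `n` qubits and an ancilla. -/
def ancillaEquiv (n : ℕ) : Fin (2 ^ n) × Fin 2 ≃ (Fin (n + 1) → Fin 2) :=
  (Equiv.prodComm _ _).trans
    (((Equiv.refl (Fin 2)).prodCongr (bits n)).trans (Fin.snocEquiv fun _ => Fin 2))

theorem ancillaEquiv_apply {n : ℕ} (i : Fin (2 ^ n)) (a : Fin 2) :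
    ancillaEquiv n (i, a) = Fin.snoc (bits n i) a := rfl

open Kronecker in
-- In the form `R ⊗ I`, concatenation and reversal of circuits turn directly into products and
-- adjoints of the implemented matrices.
theorem implementsWithAncilla_iff {n : ℕ} {G : Circuit (n + 1)}
    {R : Matrix (Fin (2 ^ n)) (Fin (2 ^ n)) ℂ} :
    ImplementsWithAncilla G R ↔
      (circuitMat G).submatrix (ancillaEquiv n) (ancillaEquiv n) = R ⊗ₖ 1 := by
  constructor
  · intro h
    ext ⟨i, a⟩ ⟨j, b⟩
    rw [submatrix_apply, ancillaEquiv_apply, ancillaEquiv_apply, h, kronecker_apply,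
      Matrix.one_apply]
    simp
  · intro h i j a b
    have := congrFun (congrFun h (i, a)) (j, b)
    rw [submatrix_apply, ancillaEquiv_apply, ancillaEquiv_apply, kronecker_apply,
      Matrix.one_apply] at this
    rw [this]
    simp

/-- `R` is implemented by a circuit with one ancilla and at most `h` Hadamard gates, `z` gates `Z`
and `c` classical gates. -/
def Realizable {n : ℕ} (R : Matrix (Fin (2 ^ n)) (Fin (2 ^ n)) ℂ) (h z c : ℕ) : Prop :=
  ∃ G : Circuit (n + 1), ImplementsWithAncilla G R ∧ G.countP Gate.isHad ≤ h ∧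
    G.countP Gate.isZ ≤ z ∧ G.countP Gate.isClassical ≤ c

section Realizable

variable {n : ℕ} {R R' : Matrix (Fin (2 ^ n)) (Fin (2 ^ n)) ℂ} {h z c h' z' c' : ℕ}

theorem Realizable.mono (hR : Realizable R h z c) (hh : h ≤ h') (hz : z ≤ z') (hc : c ≤ c') :
    Realizable R h' z' c' := by
  obtain ⟨G, h0, h1, h2, h3⟩ := hR
  exact ⟨G, h0, h1.trans hh, h2.trans hz, h3.trans hc⟩

theorem Realizable.mul (hR : Realizable R h z c) (hR' : Realizable R' h' z' c') :
    Realizable (R * R') (h + h') (z + z') (c + c') := by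
  obtain ⟨G, h0, h1, h2, h3⟩ := hR
  obtain ⟨G', h0', h1', h2', h3'⟩ := hR'
  refine ⟨G ++ G', ?_, ?_, ?_, ?_⟩
  · rw [implementsWithAncilla_iff] at *
    rw [circuitMat_append, ← submatrix_mul_equiv _ _ _ (ancillaEquiv n), h0, h0',
      ← mul_kronecker_mul, Matrix.one_mul]
  all_goals rw [List.countP_append]; omega

theorem Realizable.conjTranspose (hR : Realizable R h z c) : Realizable Rᴴ h z c := by
  obtain ⟨G, h0, h1, h2, h3⟩ := hR
  refine ⟨G.reverse, ?_, ?_, ?_, ?_⟩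
  · rw [implementsWithAncilla_iff] at *
    rw [circuitMat_reverse, ← conjTranspose_submatrix, h0, conjTranspose_kronecker,
      conjTranspose_one]
  all_goals rwa [List.countP_reverse]

/-- Circuits are unitary, so `R * Rᴴ ⊗ I` is the identity; its block at ancilla value `0` gives the
claim. -/
theorem Realizable.mem_unitaryGroup (hR : Realizable R h z c) :
    R ∈ Matrix.unitaryGroup (Fin (2 ^ n)) ℂ := by
  obtain ⟨G, h0, -⟩ := hR
  rw [implementsWithAncilla_iff] at h0
  have h1 := congrArg₂ (· * ·) h0 (congrArg Matrix.conjTranspose h0)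
  simp only [conjTranspose_submatrix, conjTranspose_kronecker, conjTranspose_one,
    ← mul_kronecker_mul, Matrix.one_mul, submatrix_mul_equiv, circuitMat_mul_conjTranspose,
    submatrix_one_equiv] at h1
  rw [mem_unitaryGroup_iff, star_eq_conjTranspose]
  ext i j
  have := congrFun (congrFun h1 (i, 0)) (j, 0)
  rw [kronecker_apply, Matrix.one_apply_eq, mul_one] at this
  rw [← this, Matrix.one_apply, Matrix.one_apply]
  simp

theorem countP_of_isClassical {N : ℕ} {G : Circuit N} (hG : IsClassical G) :
    G.countP Gate.isHad = 0 ∧ G.countP Gate.isZ = 0 := by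
  constructor <;> refine List.countP_eq_zero.mpr fun g hg => ?_
  all_goals
    have := hG g hg
    cases g <;> simp_all [Gate.isClassical, Gate.isHad, Gate.isZ]

/-- A classical circuit that permutes the basis states implements the permutation matrix. -/
theorem realizable_of_isClassical {G : Circuit (n + 1)} (hG : IsClassical G)
    {π : Fin (2 ^ n) → Fin (2 ^ n)}
    (hπ : ∀ j b, run G (Fin.snoc (bits n j) b) = Fin.snoc (bits n (π j)) b) :
    Realizable (Matrix.of fun i j => if i = π j then (1 : ℂ) else 0) 0 0 G.length := by
  refine ⟨G, fun i j a b => ?_, (countP_of_isClassical hG).1.le, (countP_of_isClassical hG).2.le,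
    List.countP_le_length⟩
  rw [circuitMat_eq_basisMap hG, basisMap, of_apply, hπ, of_apply, ← ite_and]
  simp only [← ancillaEquiv_apply, (ancillaEquiv n).injective.eq_iff, Prod.mk.injEq, and_comm]

theorem implementsWithAncilla_diagonal {G : Circuit (n + 1)} {d : (Fin (n + 1) → Fin 2) → ℂ}
    {r : Fin (2 ^ n) → ℂ} (hG : circuitMat G = diagonal d)
    (hd : ∀ i a, d (Fin.snoc (bits n i) a) = r i) : ImplementsWithAncilla G (diagonal r) := by
  intro i j a b
  rw [hG]
  by_cases hij : i = j
  · subst hij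
    by_cases hab : a = b
    · subst hab; simp [hd]
    · rw [if_neg hab, diagonal_apply_ne]
      simp only [← ancillaEquiv_apply, ne_eq, (ancillaEquiv n).injective.eq_iff, Prod.mk.injEq]
      tauto
  · rw [diagonal_apply_ne, diagonal_apply_ne _ hij, ite_self]
    simp only [← ancillaEquiv_apply, ne_eq, (ancillaEquiv n).injective.eq_iff, Prod.mk.injEq]
    tauto

/-! ### Circuits for Pauli strings and the increment -/

theorem realizable_one : Realizable (1 : Matrix (Fin (2 ^ n)) (Fin (2 ^ n)) ℂ) 0 0 0 := by
  refine ⟨[], ?_, by simp, by simp, by simp⟩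
  rw [← diagonal_one]
  exact implementsWithAncilla_diagonal (d := fun _ => 1) diagonal_one.symm fun _ _ => rfl

theorem circuitMat_map_z {N : ℕ} (l : List (Fin N)) :
    circuitMat (l.map Gate.z) = diagonal fun s => (((l.map fun q => sign (s q)).prod : ℝ) : ℂ) := by
  induction l with
  | nil => simp [circuitMat]
  | cons q l ih =>
    rw [List.map_cons, circuitMat_cons, ih, Gate.mat, onWire_pauliZ, diagonal_mul_diagonal]
    simp

theorem realizable_zString (α : Finset (Fin n)) : Realizable (zString α) 0 α.card 0 := by
  refine ⟨(α.toList.map Fin.castSucc).map Gate.z, ?_, ?_, ?_, ?_⟩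
  · rw [zString_eq_diagonal]
    refine implementsWithAncilla_diagonal (circuitMat_map_z _) fun i a => ?_
    simp [character, Function.comp_def]
  · simp [List.countP_eq_zero, Gate.isHad]
  · exact List.countP_le_length.trans (by simp)
  · simp [List.countP_eq_zero, Gate.isClassical]

theorem realizable_zLast (hn : 0 < n) : Realizable (zLast n) 0 1 0 := by
  obtain ⟨n, rfl⟩ := Nat.exists_eq_succ_of_ne_zero hn.ne'
  rw [zLast_succ]
  exact realizable_zString _

/-- The wires of the main register, least significant bit first. -/
def mainWires (n : ℕ) : List (Fin (n + 1)) := List.ofFn fun q : Fin n => q.rev.castSucc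

theorem mem_mainWires {w : Fin (n + 1)} : w ∈ mainWires n ↔ w ≠ Fin.last n := by
  rw [mainWires, List.mem_ofFn']
  constructor
  · rintro ⟨q, rfl⟩; exact Fin.castSucc_ne_last _
  · intro hw
    exact ⟨(w.castPred hw).rev, by simp⟩

theorem nodup_mainWires : (Fin.last n :: mainWires n).Nodup := by
  rw [List.nodup_cons, mem_mainWires]
  refine ⟨by simp, List.nodup_ofFn.mpr fun a b hab => ?_⟩
  simpa using hab

theorem val_ofFn {N : ℕ} : ∀ {m : ℕ} (f : Fin m → Fin N) (s : Fin N → Fin 2),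
    val (List.ofFn f) s = ∑ q, (s (f q)).val * 2 ^ q.val
  | 0, f, s => by simp [val]
  | m + 1, f, s => by
    rw [List.ofFn_succ, val, val_ofFn, Fin.sum_univ_succ, Finset.mul_sum]
    congr 1
    · simp
    · exact Finset.sum_congr rfl fun q _ => by rw [Fin.val_succ, pow_succ]; ring

theorem val_mainWires (i : Fin (2 ^ n)) (a : Fin 2) :
    val (mainWires n) (Fin.snoc (bits n i) a) = i.val := by
  rw [mainWires, val_ofFn, val_eq_sum_bits]
  simp

theorem eq_snoc {s : Fin (n + 1) → Fin 2} {i : Fin (2 ^ n)} {a : Fin 2}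
    (hv : val (mainWires n) s = i.val) (ha : s (Fin.last n) = a) : s = Fin.snoc (bits n i) a := by
  funext w
  by_cases hw : w = Fin.last n
  · rw [hw, ha, Fin.snoc_last]
  · exact eq_of_val_eq (hv.trans (val_mainWires i a).symm) w (mem_mainWires.mpr hw)

theorem realizable_increment : Realizable (increment n) 0 0 (22 * n + 4) := by
  have hpos : 0 < 2 ^ n := by positivity
  have hl : (mainWires n).length = n := by simp [mainWires]
  have := realizable_of_isClassical (isClassical_incrementer (mainWires n) (Fin.last n))
    (π := fun j => ⟨(j.val + 1) % 2 ^ n, Nat.mod_lt _ hpos⟩) fun j b => by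
      obtain ⟨h1, h2⟩ := run_incrementer nodup_mainWires (Fin.snoc (bits n j) b)
      refine eq_snoc ?_ ?_
      · rw [val_mainWires, hl] at h2
        have h3 := val_lt (run (incrementer (mainWires n) (Fin.last n)) (Fin.snoc (bits n j) b))
          (mainWires n)
        rw [hl] at h3
        rw [Nat.ModEq, Nat.mod_eq_of_lt h3] at h2
        exact h2
      · rw [h1 _ (by simp [mem_mainWires]), Fin.snoc_last]
  convert this.mono le_rfl le_rfl (length_incrementer_le _ _) using 1
  · ext i j
    simp [increment, Fin.ext_iff, eq_comm]
  · rw [hl]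

theorem run_map_x {N : ℕ} : ∀ {ws : List (Fin N)}, ws.Nodup → ∀ s : Fin N → Fin 2,
    (∀ w, w ∉ ws → run (ws.map Gate.x) s w = s w) ∧
      ∀ w ∈ ws, run (ws.map Gate.x) s w = s w + 1
  | [], _, s => by simp [run_nil]
  | x :: ws, hn, s => by
    rw [List.nodup_cons] at hn
    obtain ⟨h1, h2⟩ := run_map_x hn.2 s
    rw [List.map_cons, run_cons, Gate.act]
    refine ⟨fun w hw => ?_, fun w hw => ?_⟩
    · simp only [List.mem_cons, not_or] at hw
      rw [Function.update_of_ne hw.1, h1 w hw.2]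
    · by_cases h : w = x
      · rw [h, Function.update_self, h1 x hn.1]
      · rw [Function.update_of_ne h]
        exact h2 w ((List.mem_cons.mp hw).resolve_left h)

theorem isClassical_map_x {N : ℕ} (ws : List (Fin N)) : IsClassical (ws.map Gate.x) := by
  intro g hg
  obtain ⟨w, -, rfl⟩ := List.mem_map.mp hg
  rfl

theorem realizable_xAll : Realizable (xAll n) 0 0 n := by
  have := realizable_of_isClassical (isClassical_map_x (mainWires n))
    (π := fun j => (bits n).symm fun q => bits n j q + 1) fun j b => by
      obtain ⟨h1, h2⟩ := run_map_x (List.nodup_cons.mp nodup_mainWires).2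
        (Fin.snoc (bits n j) b : Fin (n + 1) → Fin 2)
      funext w
      refine Fin.lastCases ?_ (fun q => ?_) w
      · rw [h1 _ (by simp [mem_mainWires]), Fin.snoc_last, Fin.snoc_last]
      · rw [h2 _ (by simp [mem_mainWires]), Fin.snoc_castSucc, Fin.snoc_castSucc]
        simp
  convert this using 1
  · ext i j
    rw [xAll_apply, of_apply]
    congr 1
    rw [add_one_iff_bits, Equiv.eq_symm_apply, funext_iff]
  · simp [mainWires]

/-! ### Circuits for the signed antidiagonal matrix -/

theorem val_eq_zero_iff_bits (i : Fin (2 ^ n)) : i.val = 0 ↔ ∀ q, bits n i q = 0 := by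
  rw [val_eq_sum_bits, Finset.sum_eq_zero_iff]
  constructor
  · intro h q
    have := h q.rev (Finset.mem_univ _)
    rw [Fin.rev_rev] at this
    exact Fin.ext ((Nat.mul_eq_zero.mp this).resolve_right (by positivity))
  · intro h q _
    rw [h]; simp

/-- The corners lie in the first and last columns, whose indices are the two bit strings with all
bits equal; there the sign differs from that of `X^{⊗n}`. -/
theorem neg_cMinus_eq (hn : 0 < n) : -cMinus n = xAll n *
    diagonal fun j => if ∀ q, bits n j q = bits n j ⟨0, hn⟩ then (-1 : ℂ) else 1 := by
  ext i j
  rw [mul_diagonal, xAll_apply, Matrix.neg_apply, cMinus, of_apply]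
  split_ifs with h1 h2 h3 h3
  · simp
  · exfalso
    refine h3 fun q => ?_
    rw [add_one_iff_bits] at h1
    rcases h2 with h2 | h2
    · rw [val_eq_zero_iff_bits] at h2
      have cancel : ∀ a b : Fin 2, 0 = a + 1 → 0 = b + 1 → a = b := by decide
      exact cancel _ _ ((h2 q).symm.trans (h1 q)) ((h2 _).symm.trans (h1 _))
    · rw [val_eq_zero_iff_bits] at h2
      rw [h2, h2]
  · exfalso
    apply h2
    rw [add_one_iff_bits] at h1
    simp only [val_eq_zero_iff_bits, h1]
    have two : ∀ a : Fin 2, a = 0 ∨ a = 1 := by decide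
    rcases two (bits n j ⟨0, hn⟩) with h0 | h0 <;> rw [h0] at h3
    · exact Or.inr h3
    · exact Or.inl fun q => by rw [h3]; rfl
  · simp
  · simp
  · simp

/-- The phase flip on the two basis states whose bits all agree. -/
theorem realizable_constant_phase (m : ℕ) : Realizable (n := m + 2)
    (diagonal fun j => if ∀ q, bits (m + 2) j q = bits (m + 2) j ⟨0, by omega⟩ then -1 else 1)
    2 0 (48 * m + 40) := by
  set a : Fin (m + 3) := 0 with ha
  set t : Fin (m + 3) := (1 : Fin (m + 2)).castSucc with ht
  set cs : List (Fin (m + 3)) := List.ofFn fun q : Fin m => q.succ.succ.castSucc with hcs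
  set P : Circuit (m + 3) := (t :: cs).map Gate.x ++ fanout a (t :: cs) with hP
  have hmem : ∀ w, w ∈ t :: cs ↔ ∃ q : Fin (m + 1), w = q.succ.castSucc := by
    intro w
    rw [List.mem_cons, hcs, List.mem_ofFn']
    constructor
    · rintro (rfl | ⟨q, rfl⟩)
      · exact ⟨0, rfl⟩
      · exact ⟨q.succ, rfl⟩
    · rintro ⟨q, rfl⟩
      refine Fin.cases (Or.inl rfl) (fun q => Or.inr ⟨q, rfl⟩) q
  have hnd : (t :: cs).Nodup := by
    have : t :: cs = List.ofFn fun q : Fin (m + 1) => q.succ.castSucc := by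
      rw [List.ofFn_succ]; rfl
    rw [this, List.nodup_ofFn]
    intro q q' hq
    simpa using hq
  have hna : (a :: t :: cs).Nodup := by
    refine List.nodup_cons.mpr ⟨fun h => ?_, hnd⟩
    obtain ⟨q, hq⟩ := (hmem a).mp h
    exact absurd (congrArg Fin.val hq) (by rw [ha]; exact (Nat.succ_ne_zero _).symm)
  have hnb : (Fin.last (m + 2) :: (cs ++ [t])).Nodup := by
    have : (Fin.last (m + 2) :: t :: cs).Nodup := by
      refine List.nodup_cons.mpr ⟨fun h => ?_, hnd⟩
      obtain ⟨q, hq⟩ := (hmem _).mp h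
      exact Fin.castSucc_ne_last _ hq.symm
    exact ((List.perm_append_comm (l₁ := cs) (l₂ := [t])).cons _).nodup_iff.mpr this
  have hPc : IsClassical P := isClassical_append (isClassical_map_x _) (isClassical_fanout _ _)
  have hMc := isClassical_multiNot cs t (Fin.last (m + 2))
  have hcl : cs.length = m := by simp [hcs]
  -- After `P`, every wire other than `a` holds `1` exactly when it agreed with `a`, so equality of
  -- all bits has become a single conjunction.
  have hrun : ∀ s w, w ∈ t :: cs → run P s w = s w + s a + 1 := by
    intro s w hw
    rw [hP, run_append, (run_map_x hnd _).2 w hw, (run_fanout hna s).2 w hw]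
  refine ⟨P.reverse ++ ([.had t] ++ multiNot cs t (Fin.last (m + 2)) ++ [.had t]) ++ P,
    implementsWithAncilla_diagonal
      (d := fun s => if conj (t :: cs) (run P s) = 1 then -1 else 1) ?_ ?_, ?_, ?_, ?_⟩
  · simp only [circuitMat_append, circuitMat_singleton, Gate.mat]
    rw [circuitMat_eq_basisMap hMc, circuitMat_eq_basisMap hPc,
      circuitMat_eq_basisMap (isClassical_reverse hPc)]
    have : run (multiNot cs t (Fin.last (m + 2))) =
        fun s => Function.update s t (s t + conj cs s) := funext (run_multiNot hnb)
    rw [this, hadamard_conj_basisMap t (conj cs) fun s b => conj_congr fun w hw =>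
      Function.update_of_ne (by rintro rfl; exact (List.nodup_cons.mp hnd).1 hw) _ _]
    have and_mul : ∀ a b : Fin 2, a = 1 ∧ b = 1 ↔ a * b = 1 := by decide
    -- Conjugating a diagonal matrix by the permutation `P` just evaluates its entries at the
    -- permuted state.
    have inv : run P.reverse ∘ run P = id := funext (run_reverse_run P)
    rw [Matrix.mul_assoc, diagonal_mul_basisMap, ← Matrix.mul_assoc, basisMap_mul, inv, basisMap_id,
      Matrix.one_mul]
    simp only [and_mul, conj, Function.comp_def]
    rfl
  · intro i b
    congr 1
    rw [conj_eq_one_iff_forall, eq_iff_iff]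
    have cancel : ∀ a b : Fin 2, a + b + 1 = 1 ↔ a = b := by decide
    have e0 : (Fin.snoc (bits (m + 2) i) b : Fin (m + 3) → Fin 2) a = bits (m + 2) i 0 := by
      have : a = (0 : Fin (m + 2)).castSucc := rfl
      rw [this, Fin.snoc_castSucc]
    constructor
    · intro h q
      refine Fin.cases rfl (fun q => ?_) q
      have := h _ ((hmem _).mpr ⟨q, rfl⟩)
      rw [hrun _ _ ((hmem _).mpr ⟨q, rfl⟩), cancel, Fin.snoc_castSucc, e0] at this
      exact this
    · intro h w hw
      rw [hrun _ _ hw, cancel, e0]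
      obtain ⟨q, rfl⟩ := (hmem w).mp hw
      rw [Fin.snoc_castSucc]
      exact h _
  · simp only [List.countP_append, List.countP_reverse, (countP_of_isClassical hPc).1,
      (countP_of_isClassical hMc).1]
    simp [Gate.isHad]
  · simp only [List.countP_append, List.countP_reverse, (countP_of_isClassical hPc).2,
      (countP_of_isClassical hMc).2]
    simp [Gate.isZ]
  · refine List.countP_le_length.trans ?_
    have h1 := length_fanout_le a (t :: cs)
    have h2 := length_multiNot_le cs t (Fin.last (m + 2))
    simp only [hP, List.length_append, List.length_reverse, List.length_map, List.length_cons,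
      List.length_nil, hcl] at *
    omega

theorem realizable_neg_cMinus (hn : 2 ≤ n) : Realizable (-cMinus n) 2 0 (50 * n) := by
  rw [neg_cMinus_eq (by omega)]
  obtain ⟨m, rfl⟩ := Nat.exists_eq_add_of_le' hn
  exact (realizable_xAll.mul (realizable_constant_phase m)).mono (by omega) (by omega) (by omega)

/-! ### The one-qubit case and the gate budget -/

theorem zLast_eq_diagonal (hn : 0 < n) :
    zLast n = diagonal fun i => if i.val % 2 = 0 then 1 else -1 := by
  ext i j
  have := zLast_mul_apply hn 1 i j
  rw [Matrix.mul_one, Matrix.one_apply] at this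
  rw [this, diagonal_apply]
  split_ifs <;> simp

/-- On one qubit both antidiagonal entries are corners, so `-C_1^- = -X`, and `Z` anticommutes with
`X`. -/
theorem zLast_one_mul_neg_cMinus : zLast 1 * -cMinus 1 = xAll 1 * zLast 1 := by
  rw [zLast_eq_diagonal one_pos]
  ext i j
  rw [diagonal_mul, mul_diagonal, xAll_apply, Matrix.neg_apply, cMinus, of_apply]
  fin_cases i <;> fin_cases j <;> simp

theorem neg_cMinus_one : -cMinus 1 = zLast 1 * (xAll 1 * zLast 1) := by
  rw [zLast_eq_diagonal one_pos]
  ext i j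
  rw [diagonal_mul, mul_diagonal, xAll_apply, Matrix.neg_apply, cMinus, of_apply]
  fin_cases i <;> fin_cases j <;> simp

/-- On one qubit, one of the two `Z` gates is replaced by a conjugated `X` gate. -/
theorem realizable_zLast_one : Realizable (zLast 1) 2 0 1 := by
  refine ⟨[.had 0, .x 0, .had 0], ?_, by simp [List.countP_cons, Gate.isHad],
    by simp [Gate.isZ], by simp [List.countP_cons, Gate.isClassical]⟩
  rw [zLast_succ, zString_eq_diagonal]
  refine implementsWithAncilla_diagonal (d := fun s => ((sign (s 0) : ℝ) : ℂ)) ?_ fun i a => ?_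
  · rw [← onWire_pauliZ, ← hadamard_mul_pauliX_mul_hadamard]
    simp [circuitMat_cons, circuitMat_nil, Gate.mat, onWire_mul, Matrix.mul_assoc]
  · rw [character, Finset.prod_singleton]
    have : (0 : Fin 2) = (Fin.last 0).castSucc := rfl
    rw [this, Fin.snoc_castSucc]

/-- For `n = 1`, `-X = Z X Z` would use two `Z` gates, while `k = 0` allows only one; the other is
written as `H X H`, which just fits the two Hadamards. -/
theorem realizable_neg_cMinus_of_pos (hn : 0 < n) : Realizable (-cMinus n) 2 1 (50 * n) := by
  by_cases h : 2 ≤ n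
  · exact (realizable_neg_cMinus h).mono le_rfl (by omega) le_rfl
  · obtain rfl : n = 1 := by omega
    rw [neg_cMinus_one]
    exact ((realizable_zLast one_pos).mul (realizable_xAll.mul realizable_zLast_one)).mono
      (by omega) (by omega) (by omega)

theorem realizable_zLast_mul_neg_cMinus (hn : 0 < n) :
    Realizable (zLast n * -cMinus n) 2 1 (50 * n) := by
  by_cases h : 2 ≤ n
  · exact ((realizable_zLast hn).mul (realizable_neg_cMinus h)).mono (by omega) (by omega)
      (by omega)
  · obtain rfl : n = 1 := by omega
    rw [zLast_one_mul_neg_cMinus]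
    exact (realizable_xAll.mul (realizable_zLast one_pos)).mono (by omega) (by omega) (by omega)

theorem realizable_lcuTerm {k : ℕ} (hn : 0 < n) (l : TermIndex n k) :
    Realizable (lcuTerm n k l) 2 (k + 1) (50 * n) := by
  have hS : Realizable (increment n) 0 0 (50 * n) :=
    realizable_increment.mono le_rfl le_rfl (by omega)
  have hX : Realizable (xAll n) 0 0 (50 * n) := realizable_xAll.mono le_rfl le_rfl (by omega)
  rcases l with i | ⟨⟨α, hα⟩, i⟩
  · fin_cases i
    · exact realizable_one.mono (by omega) (by omega) (by omega)
    · exact hS.mono (by omega) (by omega) le_rfl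
    · exact hS.conjTranspose.mono (by omega) (by omega) le_rfl
    · exact hX.mono (by omega) (by omega) le_rfl
    · exact (realizable_neg_cMinus_of_pos hn).mono le_rfl (by omega) le_rfl
  · have hZ := realizable_zString α
    fin_cases i
    · exact (hZ.mul hS.conjTranspose).mono (by omega) (by omega) (by omega)
    · exact (hZ.mul hS).mono (by omega) (by omega) (by omega)
    · exact (hZ.mul ((realizable_zLast hn).mul hX)).mono (by omega) (by omega) (by omega)
    · exact (hZ.mul (realizable_zLast_mul_neg_cMinus hn)).mono (by omega) (by omega) (by omega)

end Realizable

end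

end PoissonLCU

theorem theorem5 :
    ∃ C : ℕ, ∀ (n k : ℕ), 2 * k < n → ∀ p : Polynomial ℝ, p.natDegree ≤ k →
      -- the expansion of the diagonal matrix into `Z` strings of weight at most `k`
      PoissonLCU.gridDiagonal n p
          = ∑ α : PoissonLCU.LowWeight n k,
              ((PoissonLCU.polyCoeff k p α.1 : ℝ) : ℂ) • PoissonLCU.zString α.1 ∧
      -- the linear combination of unitaries
      PoissonLCU.normalizedLaplacian n
            + ((PoissonLCU.step n ^ 2 : ℝ) : ℂ) •
              (PoissonLCU.gridDiagonal n p * PoissonLCU.centralDifference n)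
          = ∑ l : PoissonLCU.TermIndex n k,
              ((PoissonLCU.lcuCoeff n k p l : ℝ) : ℂ) • PoissonLCU.lcuTerm n k l ∧
      Fintype.card (PoissonLCU.TermIndex n k) ≤ C * n ^ k ∧
      ∀ l : PoissonLCU.TermIndex n k,
        PoissonLCU.lcuTerm n k l ∈ Matrix.unitaryGroup (Fin (2 ^ n)) ℂ ∧
        ∃ G : PoissonLCU.Circuit (n + 1),
          PoissonLCU.ImplementsWithAncilla G (PoissonLCU.lcuTerm n k l) ∧
          G.countP PoissonLCU.Gate.isHad ≤ 2 ∧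
          G.countP PoissonLCU.Gate.isZ ≤ k + 1 ∧
          G.countP PoissonLCU.Gate.isClassical ≤ C * n := by
  -- The gate count dictates the constant `50`; the number of terms needs only `13`.
  refine ⟨50, fun n k hk p hp => ?_⟩
  have hn : 0 < n := by omega
  refine ⟨PoissonLCU.gridDiagonal_eq_sum hp, PoissonLCU.linear_combination_eq hn hp,
    (PoissonLCU.card_termIndex_le hk).trans (Nat.mul_le_mul_right _ (by norm_num)), fun l => ?_⟩
  have hl := PoissonLCU.realizable_lcuTerm hn l
  exact ⟨hl.mem_unitaryGroup, hl⟩
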